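/- **Theorem 3.1.** Let $\mathbb{K}$ be $\mathbb{R}$ or $\mathbb{C}$ and let $\mathfrak{g}$ be a finite-dimensional Lie superalgebra over $\mathbb{K}$. *Notation.* For a finite-dimensional super vector space $V$, let $S(V)$ be its supersymmetric algebra. The Weyl superalgebra $\mathscr{A}(V)$ is the subalgebra of $\mathrm{End}_{\mathbb{K}}(S(V))$ generated by the multiplications with elements of $V$ and the super derivations of $S(V)$. Identify $S(V^*)$ with the algebra of operators on $S(V)$ generated by the partial derivatives, and let $\widehat{S}(V^*)=\prod_{j\ge 0}S^j(V^*)\subset \mathrm{End}_{\mathbb{K}}(S(V))$ be its completion (formal power series in the partial derivatives, which act on each element of $S(V)$ through finitely many terms). The completed Weyl superalgebra $\widehat{\mathscr{A}}(V)$ is the subalgebra of $\mathrm{End}_{\mathbb{K}}(S(V))$ generated by $\mathscr{A}(V)$ and $\widehat{S}(V^*)$. Both $\mathscr{A}(V)$ and $\widehat{\mathscr{A}}(V)$ are regarded as Lie superalgebras with the supercommutator as bracket. Morphisms of Lie superalgebras, and in particular characters (morphisms to $\mathbb{K}$), are even. (i) There is an injective Lie superalgebra morphism $\mathfrak{g}\hookrightarrow\widehat{\mathscr{A}}(\mathfrak{g})$.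 (ii) Let $\mathfrak{g}=\bigoplus_{i\in\mathbb{Z}}\mathfrak{g}_i$ be a $\mathbb{Z}$-grading, that is, a decomposition as super vector spaces with $[\mathfrak{g}_i,\mathfrak{g}_j]\subset\mathfrak{g}_{i+j}$. Put $\mathfrak{g}_-=\bigoplus_{i<0}\mathfrak{g}_i$ and $\mathfrak{k}=\bigoplus_{i\ge 0}\mathfrak{g}_i$. Let $\lambda$ be a character of $\mathfrak{g}_0$, extended to $\mathfrak{k}$ by zero on $\bigoplus_{i>0}\mathfrak{g}_i$, and let $\mathbb{K}_\lambda$ be the corresponding one-dimensional $\mathfrak{k}$-module. Then there is a Lie superalgebra morphism $$\phi_\lambda:\mathfrak{g}\to\mathscr{A}(\mathfrak{g}_-)$$ such that $S(\mathfrak{g}_-)$, with the action of $\mathfrak{g}$ through $\phi_\lambda$, is isomorphic as a $\mathfrak{g}$-module to the parabolic Verma module $U(\mathfrak{g})\otimes_{U(\mathfrak{k})}\mathbb{K}_\lambda$, by an isomorphism that sends $1$ to $1\otimes 1$; and $\phi_\lambda$ is injective if and only if $U(\mathfrak{g})\otimes_{U(\mathfrak{k})}\mathbb{K}_\lambda$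 is a faithful $\mathfrak{g}$-module (no nonzero element of $\mathfrak{g}$ acts as zero). -/

import Mathlib

open scoped TensorProduct

noncomputable section

/-! ## Super vector spaces and Lie superalgebras -/

/-- A super vector space: a vector space `V` with a decomposition `V = V₀ ⊕ V₁` into an even part
`parity 0` and an odd part `parity 1`. -/
class SuperModule (𝕜 V : Type*) [Field 𝕜] [AddCommGroup V] [Module 𝕜 V] where
  parity : ZMod 2 → Submodule 𝕜 V
  isCompl : IsCompl (parity 0) (parity 1)

/-- The sign `(-1)^{ij}` attached to two parities `i` and `j`. -/
def superSign (𝕜 : Type*) [Field 𝕜] (i j : ZMod 2) : 𝕜 := (-1) ^ (i.val * j.val)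

/-- A Lie superalgebra over a field of characteristic zero. -/
class LieSuperalgebra (𝕜 g : Type*) [Field 𝕜] [AddCommGroup g] [Module 𝕜 g] extends
    SuperModule 𝕜 g where
  /-- the superbracket -/
  br : g →ₗ[𝕜] g →ₗ[𝕜] g
  br_mem : ∀ {i j : ZMod 2} {x y : g}, x ∈ parity i → y ∈ parity j → br x y ∈ parity (i + j)
  /-- super skew-symmetry -/
  br_skew : ∀ {i j : ZMod 2} {x y : g}, x ∈ parity i → y ∈ parity j →
    br x y = -(superSign 𝕜 i j • br y x)
  /-- super Jacobi identity -/
  br_jacobi : ∀ {i j : ZMod 2} {x y : g} (z : g), x ∈ parity i → y ∈ parity j →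
    br x (br y z) = br (br x y) z + superSign 𝕜 i j • br y (br x z)

open SuperModule LieSuperalgebra

/-- A Lie superalgebra morphism from `g` to an associative superalgebra `A = A₀ ⊕ A₁`, the latter
being regarded as a Lie superalgebra for the supercommutator `ab - (-1)^{|a||b|} ba`:
an even linear map which respects the brackets. -/
structure IsLieSuperHom {𝕜 g A : Type*} [Field 𝕜] [AddCommGroup g] [Module 𝕜 g]
    [LieSuperalgebra 𝕜 g] [Ring A] [Algebra 𝕜 A] (𝒜 : ZMod 2 → Submodule 𝕜 A)
    (φ : g →ₗ[𝕜] A) : Prop where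
  map_parity : ∀ (i : ZMod 2) (x : g), x ∈ parity (𝕜 := 𝕜) i → φ x ∈ 𝒜 i
  map_br : ∀ (i j : ZMod 2) (x y : g), x ∈ parity (𝕜 := 𝕜) i → y ∈ parity (𝕜 := 𝕜) j →
    φ (br (𝕜 := 𝕜) x y) = φ x * φ y - superSign 𝕜 i j • (φ y * φ x)

/-- A Lie sub-superalgebra: a sub super vector space which is closed under the bracket. -/
structure LieSubsuperalgebra (𝕜 g : Type*) [Field 𝕜] [AddCommGroup g] [Module 𝕜 g]
    [LieSuperalgebra 𝕜 g] extends Submodule 𝕜 g where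
  graded : ∀ x ∈ toSubmodule, ∃ y ∈ toSubmodule ⊓ parity (𝕜 := 𝕜) 0,
    ∃ z ∈ toSubmodule ⊓ parity (𝕜 := 𝕜) 1, y + z = x
  br_mem' : ∀ x ∈ toSubmodule, ∀ y ∈ toSubmodule, br (𝕜 := 𝕜) x y ∈ toSubmodule

section Sub

variable {𝕜 g : Type*} [Field 𝕜] [AddCommGroup g] [Module 𝕜 g] [LieSuperalgebra 𝕜 g]

/-- A Lie sub-superalgebra is a Lie superalgebra, for the restricted parity and bracket. -/
instance LieSubsuperalgebra.instLieSuperalgebra (L : LieSubsuperalgebra 𝕜 g) :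
    LieSuperalgebra 𝕜 L.toSubmodule where
  parity i := (parity (𝕜 := 𝕜) (V := g) i).comap L.toSubmodule.subtype
  isCompl := by
    have h := SuperModule.isCompl (𝕜 := 𝕜) (V := g)
    constructor
    · rw [Submodule.disjoint_def]
      intro x hx hy
      exact Subtype.ext ((Submodule.disjoint_def.1 h.disjoint) x hx hy)
    · rw [codisjoint_iff, eq_top_iff]
      rintro ⟨x, hx⟩ -
      obtain ⟨y, hy, z, hz, rfl⟩ := L.graded x hx
      exact Submodule.mem_sup.2 ⟨⟨y, hy.1⟩, hy.2, ⟨z, hz.1⟩, hz.2, rfl⟩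
  br := LinearMap.mk₂ 𝕜 (fun x y => ⟨br (𝕜 := 𝕜) (x : g) (y : g), L.br_mem' x x.2 y y.2⟩)
    (by intros; ext; simp) (by intros; ext; simp) (by intros; ext; simp) (by intros; ext; simp)
  br_mem hx hy := br_mem (𝕜 := 𝕜) (g := g) hx hy
  br_skew hx hy := Subtype.ext (br_skew (𝕜 := 𝕜) (g := g) hx hy)
  br_jacobi z hx hy := Subtype.ext (br_jacobi (𝕜 := 𝕜) (g := g) (z : g) hx hy)

end Sub

/-! ## The universal enveloping algebra and induced modules -/

/-- The relations `xy - (-1)^{|x||y|} yx = [x, y]`, for homogeneous `x` and `y`. -/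
inductive SuperEnveloping.Rel (𝕜 g : Type*) [Field 𝕜] [AddCommGroup g] [Module 𝕜 g]
    [LieSuperalgebra 𝕜 g] : TensorAlgebra 𝕜 g → TensorAlgebra 𝕜 g → Prop
  | bracket {i j : ZMod 2} {x y : g} (hx : x ∈ parity (𝕜 := 𝕜) i) (hy : y ∈ parity (𝕜 := 𝕜) j) :
      SuperEnveloping.Rel 𝕜 g (TensorAlgebra.ι 𝕜 (br (𝕜 := 𝕜) x y))
        (TensorAlgebra.ι 𝕜 x * TensorAlgebra.ι 𝕜 y
          - superSign 𝕜 i j • (TensorAlgebra.ι 𝕜 y * TensorAlgebra.ι 𝕜 x))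

/-- The universal enveloping algebra `U(g)` of a Lie superalgebra. -/
def SuperEnveloping (𝕜 g : Type*) [Field 𝕜] [AddCommGroup g] [Module 𝕜 g]
    [LieSuperalgebra 𝕜 g] : Type _ :=
  RingQuot (SuperEnveloping.Rel 𝕜 g)

namespace SuperEnveloping

variable (𝕜 : Type*) {g A : Type*} [Field 𝕜] [AddCommGroup g] [Module 𝕜 g]
  [LieSuperalgebra 𝕜 g] [Ring A] [Algebra 𝕜 A]

instance instRing : Ring (SuperEnveloping 𝕜 g) :=
  inferInstanceAs (Ring (RingQuot (SuperEnveloping.Rel 𝕜 g)))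

instance instAlgebra : Algebra 𝕜 (SuperEnveloping 𝕜 g) :=
  inferInstanceAs (Algebra 𝕜 (RingQuot (SuperEnveloping.Rel 𝕜 g)))

/-- The canonical map `g → U(g)`. -/
def ι : g →ₗ[𝕜] SuperEnveloping 𝕜 g :=
  (RingQuot.mkAlgHom 𝕜 (SuperEnveloping.Rel 𝕜 g)).toLinearMap ∘ₗ TensorAlgebra.ι 𝕜

variable {𝕜}

theorem ι_br {i j : ZMod 2} {x y : g} (hx : x ∈ parity (𝕜 := 𝕜) i)
    (hy : y ∈ parity (𝕜 := 𝕜) j) :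
    ι 𝕜 (br (𝕜 := 𝕜) x y) = ι 𝕜 x * ι 𝕜 y - superSign 𝕜 i j • (ι 𝕜 y * ι 𝕜 x) := by
  have h := RingQuot.mkAlgHom_rel 𝕜 (Rel.bracket hx hy)
  rw [map_sub, map_smul, map_mul, map_mul] at h
  exact h

/-- The universal property of `U(g)`. -/
def lift (f : g →ₗ[𝕜] A)
    (hf : ∀ (i j : ZMod 2) (x y : g), x ∈ parity (𝕜 := 𝕜) i → y ∈ parity (𝕜 := 𝕜) j →
      f (br (𝕜 := 𝕜) x y) = f x * f y - superSign 𝕜 i j • (f y * f x)) :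
    SuperEnveloping 𝕜 g →ₐ[𝕜] A :=
  RingQuot.liftAlgHom 𝕜 ⟨TensorAlgebra.lift 𝕜 f, by
    rintro _ _ ⟨hx, hy⟩
    simpa using hf _ _ _ _ hx hy⟩

/-- The canonical algebra morphism `U(L) → U(g)`, for a Lie sub-superalgebra `L` of `g`. -/
def incl (L : LieSubsuperalgebra 𝕜 g) :
    SuperEnveloping 𝕜 L.toSubmodule →ₐ[𝕜] SuperEnveloping 𝕜 g :=
  lift (ι 𝕜 ∘ₗ L.toSubmodule.subtype) fun _ _ _ _ hx hy => ι_br hx hy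

end SuperEnveloping

/-- The `A`-submodule of `A ⊗_𝕜 N` generated by the elements `ab ⊗ v - a ⊗ bv`, where
`a ∈ A`, `b ∈ B`, `v ∈ N`. Here `B` acts on `A` from the right through the algebra morphism `f`,
and on `N` from the left through `ρ`. -/
def balancedRelations {𝕜 A B N : Type*} [Field 𝕜] [Ring A] [Algebra 𝕜 A] [Ring B] [Algebra 𝕜 B]
    [AddCommGroup N] [Module 𝕜 N] (f : B →ₐ[𝕜] A) (ρ : B →ₐ[𝕜] Module.End 𝕜 N) :
    Submodule A (A ⊗[𝕜] N) :=
  Submodule.span A {t | ∃ (a : A) (b : B) (v : N), t = (a * f b) ⊗ₜ[𝕜] v - a ⊗ₜ[𝕜] (ρ b v)}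

/-- The tensor product `A ⊗_B N` over the (noncommutative) algebra `B`, as a left `A`-module. -/
abbrev InducedModule {𝕜 A B N : Type*} [Field 𝕜] [Ring A] [Algebra 𝕜 A] [Ring B] [Algebra 𝕜 B]
    [AddCommGroup N] [Module 𝕜 N] (f : B →ₐ[𝕜] A) (ρ : B →ₐ[𝕜] Module.End 𝕜 N) : Type _ :=
  (A ⊗[𝕜] N) ⧸ balancedRelations f ρ

/-! ## ℤ-gradings and parabolic Verma modules of scalar type -/

/-- A `ℤ`-grading of a Lie superalgebra: a decomposition `g = ⨁ gₙ` as super vector spaces with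
`[gₘ, gₙ] ⊆ gₘ₊ₙ`. -/
structure LieSuperZGrading (𝕜 g : Type*) [Field 𝕜] [AddCommGroup g] [Module 𝕜 g]
    [LieSuperalgebra 𝕜 g] where
  piece : ℤ → Submodule 𝕜 g
  isInternal : DirectSum.IsInternal piece
  graded : ∀ (n : ℤ), ∀ x ∈ piece n, ∃ y ∈ piece n ⊓ parity (𝕜 := 𝕜) 0,
    ∃ z ∈ piece n ⊓ parity (𝕜 := 𝕜) 1, y + z = x
  br_mem : ∀ (m n : ℤ), ∀ x ∈ piece m, ∀ y ∈ piece n, br (𝕜 := 𝕜) x y ∈ piece (m + n)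

namespace LieSuperZGrading

variable {𝕜 g : Type*} [Field 𝕜] [AddCommGroup g] [Module 𝕜 g] [LieSuperalgebra 𝕜 g]
  (G : LieSuperZGrading 𝕜 g)

/-- For an additively closed set `s` of degrees, the Lie sub-superalgebra `⨁_{n ∈ s} gₙ`. -/
def part (s : Set ℤ) (hs : ∀ m ∈ s, ∀ n ∈ s, m + n ∈ s) : LieSubsuperalgebra 𝕜 g where
  toSubmodule := ⨆ n : s, G.piece n
  graded x hx := by
    induction hx using Submodule.iSup_induction' with
    | mem n x hx =>
      obtain ⟨y, hy, z, hz, h⟩ := G.graded n x hx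
      exact ⟨y, ⟨Submodule.mem_iSup_of_mem n hy.1, hy.2⟩, z,
        ⟨Submodule.mem_iSup_of_mem n hz.1, hz.2⟩, h⟩
    | zero => exact ⟨0, zero_mem _, 0, zero_mem _, add_zero 0⟩
    | add x x' _ _ h h' =>
      obtain ⟨y, hy, z, hz, rfl⟩ := h
      obtain ⟨y', hy', z', hz', rfl⟩ := h'
      exact ⟨y + y', add_mem hy hy', z + z', add_mem hz hz', add_add_add_comm _ _ _ _⟩
  br_mem' x hx y hy := by
    induction hx using Submodule.iSup_induction' with
    | mem m x hx =>
      induction hy using Submodule.iSup_induction' with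
      | mem n y hy =>
        exact Submodule.mem_iSup_of_mem (⟨m + n, hs m m.2 n n.2⟩ : s) (G.br_mem m n x hx y hy)
      | zero => simp
      | add y y' _ _ h h' => rw [map_add]; exact add_mem h h'
    | zero => simp
    | add x x' _ _ h h' => rw [map_add, LinearMap.add_apply]; exact add_mem h h'

/-- `g₋ = ⨁_{n < 0} gₙ`. -/
def neg : LieSubsuperalgebra 𝕜 g :=
  G.part (Set.Iio 0) fun _ hm _ hn => Set.mem_Iio.2 (add_neg (Set.mem_Iio.1 hm) (Set.mem_Iio.1 hn))

/-- `k = g₀ ⊕ g₊ = ⨁_{n ≥ 0} gₙ`. -/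
def nonneg : LieSubsuperalgebra 𝕜 g :=
  G.part (Set.Ici 0) fun _ hm _ hn => Set.mem_Ici.2 (add_nonneg (Set.mem_Ici.1 hm) (Set.mem_Ici.1 hn))

/-- `g₀`. -/
def zero : LieSubsuperalgebra 𝕜 g :=
  G.part {0} fun m hm n hn => by simp_all

theorem bijective : Function.Bijective (DirectSum.coeLinearMap G.piece) := G.isInternal

/-- The projection `g → g₀` along the sum of the other graded pieces. -/
def proj : g →ₗ[𝕜] G.zero.toSubmodule :=
  Submodule.inclusion (le_iSup (fun n : ({0} : Set ℤ) => G.piece n) ⟨0, rfl⟩) ∘ₗ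
    DirectSum.component 𝕜 ℤ (fun n => G.piece n) 0 ∘ₗ
    (LinearEquiv.ofBijective (DirectSum.coeLinearMap G.piece) G.bijective).symm.toLinearMap

theorem proj_of_mem_zero {x : g} (hx : x ∈ G.piece 0) : (G.proj x : g) = x := by
  have h : (LinearEquiv.ofBijective (DirectSum.coeLinearMap G.piece) G.bijective).symm x
      = DirectSum.lof 𝕜 ℤ (fun n => G.piece n) 0 ⟨x, hx⟩ := by
    rw [LinearEquiv.symm_apply_eq]
    simp
  simp only [proj, LinearMap.comp_apply, LinearEquiv.coe_coe, h, DirectSum.component.lof_self]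
  rfl

theorem proj_of_mem_ne {n : ℤ} (hn : n ≠ 0) {x : g} (hx : x ∈ G.piece n) : G.proj x = 0 := by
  have h : (LinearEquiv.ofBijective (DirectSum.coeLinearMap G.piece) G.bijective).symm x
      = DirectSum.lof 𝕜 ℤ (fun n => G.piece n) n ⟨x, hx⟩ := by
    rw [LinearEquiv.symm_apply_eq]
    simp
  simp [proj, h, DirectSum.component.of, hn]

theorem proj_parity {i : ZMod 2} {x : g} (hx : x ∈ parity (𝕜 := 𝕜) i) :
    G.proj x ∈ parity (𝕜 := 𝕜) i := by
  have key : ∀ x : g, ∃ y ∈ parity (𝕜 := 𝕜) 0, ∃ z ∈ parity (𝕜 := 𝕜) 1, y + z = x ∧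
      (G.proj y : g) ∈ parity (𝕜 := 𝕜) 0 ∧ (G.proj z : g) ∈ parity (𝕜 := 𝕜) 1 := by
    intro x
    have hx : x ∈ ⨆ n, G.piece n := by
      rw [G.isInternal.submodule_iSup_eq_top]; trivial
    induction hx using Submodule.iSup_induction' with
    | mem n x hx =>
      obtain ⟨y, hy, z, hz, rfl⟩ := G.graded n x hx
      refine ⟨y, hy.2, z, hz.2, rfl, ?_⟩
      by_cases hn : n = 0
      · subst hn
        rw [G.proj_of_mem_zero hy.1, G.proj_of_mem_zero hz.1]
        exact ⟨hy.2, hz.2⟩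
      · rw [G.proj_of_mem_ne hn hy.1, G.proj_of_mem_ne hn hz.1]
        exact ⟨zero_mem _, zero_mem _⟩
    | zero => exact ⟨0, zero_mem _, 0, zero_mem _, by simp⟩
    | add x x' _ _ h h' =>
      obtain ⟨y, hy, z, hz, rfl, h1, h2⟩ := h
      obtain ⟨y', hy', z', hz', rfl, h1', h2'⟩ := h'
      refine ⟨y + y', add_mem hy hy', z + z', add_mem hz hz', add_add_add_comm _ _ _ _, ?_⟩
      rw [map_add, map_add]
      exact ⟨add_mem h1 h1', add_mem h2 h2'⟩
  have hd := Submodule.disjoint_def.1 (SuperModule.isCompl (𝕜 := 𝕜) (V := g)).disjoint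
  obtain ⟨y, hy, z, hz, rfl, h1, h2⟩ := key x
  fin_cases i
  · change (G.proj (y + z) : g) ∈ parity (𝕜 := 𝕜) 0
    have hz0 : z = 0 := hd z ((Submodule.add_mem_iff_right _ hy).1 hx) hz
    subst hz0
    simpa using h1
  · change (G.proj (y + z) : g) ∈ parity (𝕜 := 𝕜) 1
    have hy0 : y = 0 := hd y hy ((Submodule.add_mem_iff_left _ hz).1 hx)
    subst hy0
    simpa using h2

theorem proj_br (x y : G.nonneg.toSubmodule) :
    G.proj (br (𝕜 := 𝕜) x y : G.nonneg.toSubmodule)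
      = br (𝕜 := 𝕜) (G.proj x) (G.proj y) := by
  obtain ⟨x, hx⟩ := x
  obtain ⟨y, hy⟩ := y
  change G.proj (br (𝕜 := 𝕜) x y) = br (𝕜 := 𝕜) (G.proj x) (G.proj y)
  change x ∈ ⨆ n : Set.Ici (0 : ℤ), G.piece n at hx
  change y ∈ ⨆ n : Set.Ici (0 : ℤ), G.piece n at hy
  induction hx using Submodule.iSup_induction' with
  | mem m x hx =>
    induction hy using Submodule.iSup_induction' with
    | mem n y hy =>
      obtain ⟨m, hm⟩ := m
      obtain ⟨n, hn⟩ := n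
      rw [Set.mem_Ici] at hm hn
      have hxy := G.br_mem m n x hx y hy
      by_cases h : m = 0
      · subst h
        by_cases h' : n = 0
        · subst h'
          refine Subtype.ext ?_
          change _ = br (𝕜 := 𝕜) (G.proj x : g) (G.proj y : g)
          rw [G.proj_of_mem_zero hx, G.proj_of_mem_zero hy]
          exact G.proj_of_mem_zero hxy
        · rw [G.proj_of_mem_ne h' hy, map_zero]
          exact G.proj_of_mem_ne (by omega) hxy
      · rw [G.proj_of_mem_ne h hx, map_zero, LinearMap.zero_apply]
        exact G.proj_of_mem_ne (by omega) hxy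
    | zero => simp
    | add y y' _ _ h h' => simp only [map_add, h, h']
  | zero => simp
  | add x x' _ _ h h' => simp only [map_add, LinearMap.add_apply, h, h']

end LieSuperZGrading

/-- The field, as a purely even superalgebra. -/
def scalarParity (𝕜 : Type*) [Field 𝕜] (i : ZMod 2) : Submodule 𝕜 𝕜 := if i = 0 then ⊤ else ⊥

/-- A character of a Lie superalgebra: a Lie superalgebra morphism to the field. -/
def IsSuperCharacter {𝕜 g : Type*} [Field 𝕜] [AddCommGroup g] [Module 𝕜 g]
    [LieSuperalgebra 𝕜 g] (χ : g →ₗ[𝕜] 𝕜) : Prop :=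
  IsLieSuperHom (scalarParity 𝕜) χ

namespace LieSuperZGrading

variable {𝕜 g : Type*} [Field 𝕜] [AddCommGroup g] [Module 𝕜 g] [LieSuperalgebra 𝕜 g]
  (G : LieSuperZGrading 𝕜 g) (χ : G.zero.toSubmodule →ₗ[𝕜] 𝕜)

/-- The extension of a linear form on `g₀` to `k = g₀ ⊕ g₊` by zero on `g₊`. -/
def extend : G.nonneg.toSubmodule →ₗ[𝕜] 𝕜 := χ ∘ₗ G.proj ∘ₗ G.nonneg.toSubmodule.subtype

variable {χ}

theorem extend_isSuperCharacter (hχ : IsSuperCharacter χ) : IsSuperCharacter (G.extend χ) where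
  map_parity i x hx := hχ.map_parity i _ (G.proj_parity hx)
  map_br i j x y hx hy := by
    have := hχ.map_br i j _ _ (G.proj_parity hx) (G.proj_parity hy)
    exact (congrArg χ (G.proj_br x y)).trans this

/-- The one-dimensional `U(k)`-module `𝕜_χ`, on which `X ∈ k` acts as the scalar `χ(X)`. -/
def scalarModule (hχ : IsSuperCharacter χ) :
    SuperEnveloping 𝕜 G.nonneg.toSubmodule →ₐ[𝕜] Module.End 𝕜 𝕜 :=
  (Algebra.lmul 𝕜 𝕜).comp (SuperEnveloping.lift (G.extend χ) (G.extend_isSuperCharacter hχ).map_br)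

/-- The parabolic Verma module `U(g) ⊗_{U(k)} 𝕜_χ` of scalar type. -/
abbrev Verma (hχ : IsSuperCharacter χ) : Type _ :=
  InducedModule (SuperEnveloping.incl G.nonneg) (G.scalarModule hχ)

end LieSuperZGrading

/-! ## The supersymmetric algebra and the Weyl superalgebras -/

/-- The relations `v w = (-1)^{|v||w|} w v`, for homogeneous `v` and `w`. -/
inductive SuperSymmetric.Rel (𝕜 V : Type*) [Field 𝕜] [AddCommGroup V] [Module 𝕜 V]
    [SuperModule 𝕜 V] : TensorAlgebra 𝕜 V → TensorAlgebra 𝕜 V → Prop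
  | comm {i j : ZMod 2} {v w : V} (hv : v ∈ parity (𝕜 := 𝕜) i) (hw : w ∈ parity (𝕜 := 𝕜) j) :
      SuperSymmetric.Rel 𝕜 V (TensorAlgebra.ι 𝕜 v * TensorAlgebra.ι 𝕜 w)
        (superSign 𝕜 i j • (TensorAlgebra.ι 𝕜 w * TensorAlgebra.ι 𝕜 v))

/-- The supersymmetric algebra `S(V)` of a super vector space over a field of characteristic
zero. -/
def SuperSymmetric (𝕜 V : Type*) [Field 𝕜] [AddCommGroup V] [Module 𝕜 V]
    [SuperModule 𝕜 V] : Type _ :=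
  RingQuot (SuperSymmetric.Rel 𝕜 V)

namespace SuperSymmetric

variable (𝕜 : Type*) {V : Type*} [Field 𝕜] [AddCommGroup V] [Module 𝕜 V] [SuperModule 𝕜 V]

instance instRing : Ring (SuperSymmetric 𝕜 V) :=
  inferInstanceAs (Ring (RingQuot (SuperSymmetric.Rel 𝕜 V)))

instance instAlgebra : Algebra 𝕜 (SuperSymmetric 𝕜 V) :=
  inferInstanceAs (Algebra 𝕜 (RingQuot (SuperSymmetric.Rel 𝕜 V)))

/-- The canonical map `V → S(V)`. -/
def ι : V →ₗ[𝕜] SuperSymmetric 𝕜 V :=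
  (RingQuot.mkAlgHom 𝕜 (SuperSymmetric.Rel 𝕜 V)).toLinearMap ∘ₗ TensorAlgebra.ι 𝕜

variable (V)

/-- The parity of `S(V)`: the part of parity `i` is spanned by the products of homogeneous
elements of `V` whose parities add up to `i`. -/
def par (i : ZMod 2) : Submodule 𝕜 (SuperSymmetric 𝕜 V) :=
  Submodule.span 𝕜 {a | ∃ l : List (ZMod 2 × V), (∀ p ∈ l, p.2 ∈ parity (𝕜 := 𝕜) p.1) ∧
    (l.map Prod.fst).sum = i ∧ a = (l.map fun p => ι 𝕜 p.2).prod}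

/-- The parity of `End(S(V))`: an operator has parity `i` if it maps elements of parity `j` to
elements of parity `i + j`. -/
def endPar (i : ZMod 2) : Submodule 𝕜 (Module.End 𝕜 (SuperSymmetric 𝕜 V)) where
  carrier := {T | ∀ j, ∀ a ∈ par 𝕜 V j, T a ∈ par 𝕜 V (i + j)}
  add_mem' hS hT j a ha := add_mem (hS j a ha) (hT j a ha)
  zero_mem' _ _ _ := zero_mem _
  smul_mem' c _ hT j a ha := Submodule.smul_mem _ c (hT j a ha)

/-- The parity of a subalgebra of `End(S(V))`, inherited from `End(S(V))`. -/
def subPar (A : Subalgebra 𝕜 (Module.End 𝕜 (SuperSymmetric 𝕜 V))) (i : ZMod 2) :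
    Submodule 𝕜 A :=
  (endPar 𝕜 V i).comap A.val.toLinearMap

variable {V}

/-- A homogeneous super derivation of `S(V)` of parity `i`. -/
def IsSuperDerivation (i : ZMod 2) (D : Module.End 𝕜 (SuperSymmetric 𝕜 V)) : Prop :=
  D ∈ endPar 𝕜 V i ∧ ∀ j, ∀ a ∈ par 𝕜 V j, ∀ b,
    D (a * b) = D a * b + superSign 𝕜 i j • (a * D b)

variable (V)

/-- The dual space `V*`, interpreted as the space of operators on `S(V)` which is spanned by the
partial derivatives, i.e. by the homogeneous super derivations which map `V` to the constants. -/
def partials : Submodule 𝕜 (Module.End 𝕜 (SuperSymmetric 𝕜 V)) :=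
  Submodule.span 𝕜 {D | (∃ i, IsSuperDerivation 𝕜 i D) ∧
    ∀ v : V, ∃ c : 𝕜, D (ι 𝕜 v) = algebraMap 𝕜 _ c}

/-- The completion `Ŝ(V*) = ∏ⱼ Sʲ(V*)` of `S(V*)`, as a set of operators on `S(V)`: the formal
series `T = ∑ⱼ Dⱼ`, where `Dⱼ` is a homogeneous polynomial of degree `j` in the partial
derivatives. Since `Dⱼ` vanishes on `Sⁿ(V)` for `j > n`, such a series acts on `Sⁿ(V)` as the
finite sum `∑_{j ≤ n} Dⱼ`. -/
def completedDual : Set (Module.End 𝕜 (SuperSymmetric 𝕜 V)) :=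
  {T | ∃ D : ℕ → Module.End 𝕜 (SuperSymmetric 𝕜 V), (∀ j, D j ∈ partials 𝕜 V ^ j) ∧
    ∀ n : ℕ, ∀ a ∈ LinearMap.range (ι 𝕜 (V := V)) ^ n, T a = ∑ j ∈ Finset.range (n + 1), D j a}

end SuperSymmetric

open SuperSymmetric in
/-- The Weyl superalgebra `A(V)`: the subalgebra of `End(S(V))` generated by the multiplications
with elements of `V` and the super derivations of `S(V)`. -/
def WeylSuper (𝕜 V : Type*) [Field 𝕜] [AddCommGroup V] [Module 𝕜 V] [SuperModule 𝕜 V] :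
    Subalgebra 𝕜 (Module.End 𝕜 (SuperSymmetric 𝕜 V)) :=
  Algebra.adjoin 𝕜 (Set.range (fun v : V => LinearMap.mulLeft 𝕜 (ι 𝕜 v)) ∪
    {D | ∃ i, IsSuperDerivation 𝕜 i D})

/-- The completed Weyl superalgebra: the subalgebra of `End(S(V))` generated by `A(V)` and
`Ŝ(V*)`. -/
def CompletedWeylSuper (𝕜 V : Type*) [Field 𝕜] [AddCommGroup V] [Module 𝕜 V] [SuperModule 𝕜 V] :
    Subalgebra 𝕜 (Module.End 𝕜 (SuperSymmetric 𝕜 V)) :=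
  Algebra.adjoin 𝕜 ((WeylSuper 𝕜 V : Set (Module.End 𝕜 (SuperSymmetric 𝕜 V))) ∪
    SuperSymmetric.completedDual 𝕜 V)

/-- A `U(g)`-module is faithful as a `g`-module if no nonzero element of `g` acts as zero. -/
def IsFaithfulSuperModule (𝕜 g M : Type*) [Field 𝕜] [AddCommGroup g] [Module 𝕜 g]
    [LieSuperalgebra 𝕜 g] [AddCommGroup M] [Module (SuperEnveloping 𝕜 g) M] : Prop :=
  ∀ x : g, (∀ m : M, SuperEnveloping.ι 𝕜 x • m = 0) → x = 0

end

noncomputable section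

open SuperModule LieSuperalgebra

set_option linter.unusedSectionVars false

/-! ## Signs -/

section Sign

variable (𝕜 : Type*) [Field 𝕜]

/-! Choose a homogeneous basis `eᵢ` of a complement of a subalgebra `k`, with a character `lam` of
`k`, and let `bᵢ`, `∂ᵢ` be the multiplications and partial derivatives on the supersymmetric algebra
of the complement. An element `x` of the Lie superalgebra should act by `X = ∑ bᵢ Fⁱ(x) + F(x)`,
where the coefficients are formal series in the `∂ᵢ`; read with the `∂ᵢ` as coordinates, this is a
vector field plus a function. The coefficients are forced by symmetrization. A symmetrization map
`β` into the induced module satisfies `β(E a) = ∑ eᵢ β(∂ᵢ a)`, with `E` the Euler operator. Moving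
`x` past `eᵢ` shows that one needs `X E = ∑ ([x, eᵢ] ∂ᵢ ± eᵢ X ∂ᵢ)` and `∑ eᵢ ∂ᵢ = E` as operators.
In characteristic zero this leads to a recursion on the degree of the coefficients, which `coeff`
solves; `sum_field_mul_partialDeriv` and `field_mul_euler` recover the two identities.

They say that the failure `defect` of the bracket relation satisfies `∑ defect(x, eᵢ) ∂ᵢ = 0`. The
super Jacobi identity then gives, on degree `n` and assuming lower degrees, `n · defect(x, z) =
-defect(px, z) - defect(x, pz)`, with `p` the projection to the complement (`defect_apply_smul`).
Taking projected arguments first makes every factor invertible, except in degree `0` with both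
arguments in `k`; there the relation says exactly that `lam` is a character. This gives `field_br`.

The Poincaré–Birkhoff–Witt theorem is not used. The universal property of the induced module gives a
map `π` from it onto the polynomial model; `π ∘ symm` and the identity obey the same Euler
recursion, so `symm` is injective. It is surjective because its image is stable under the action, by
a leading-term estimate (`bijective_symm`).

For the embedding into the completed algebra take `k = 0`: then `X` sends `1` to `x`, so the map is
injective. For a `ℤ`-grading take `k` to be the nonnegative part: every `∂ᵢ` has negative weight, so
homogeneity leaves finitely many terms in each coefficient and `X` lies in the Weyl superalgebra
itself (`field_mem_weyl`). Faithfulness is carried across the isomorphism. -/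

theorem superSign_comm (i j : ZMod 2) : superSign 𝕜 i j = superSign 𝕜 j i := by
  simp [superSign, mul_comm]

theorem superSign_eq_or (i j : ZMod 2) : superSign 𝕜 i j = 1 ∨ superSign 𝕜 i j = -1 :=
  neg_one_pow_eq_or 𝕜 _

@[simp]
theorem superSign_mul_self (i j : ZMod 2) : superSign 𝕜 i j * superSign 𝕜 i j = 1 := by
  rcases superSign_eq_or 𝕜 i j with h | h <;> simp [h]

@[simp]
theorem superSign_zero_left (i : ZMod 2) : superSign 𝕜 0 i = 1 := by simp [superSign]

@[simp]
theorem superSign_zero_right (i : ZMod 2) : superSign 𝕜 i 0 = 1 := by simp [superSign]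

theorem superSign_add_right (i j k : ZMod 2) :
    superSign 𝕜 i (j + k) = superSign 𝕜 i j * superSign 𝕜 i k := by
  have h : ∀ i j k : ZMod 2, (i.val * (j + k).val) % 2 = (i.val * j.val + i.val * k.val) % 2 := by
    decide
  rw [superSign, superSign, superSign, ← pow_add, neg_one_pow_eq_pow_mod_two, h,
    ← neg_one_pow_eq_pow_mod_two]

theorem superSign_add_left (i j k : ZMod 2) :
    superSign 𝕜 (i + j) k = superSign 𝕜 i k * superSign 𝕜 j k := by
  simp only [superSign_comm 𝕜 _ k, superSign_add_right]

end Sign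

/-! ## The supersymmetric algebra -/

namespace SuperSymmetric

section Lift

variable {𝕜 V B : Type*} [Field 𝕜] [AddCommGroup V] [Module 𝕜 V] [SuperModule 𝕜 V]
  [Ring B] [Algebra 𝕜 B]

theorem ι_mul_ι {i j : ZMod 2} {v w : V} (hv : v ∈ parity (𝕜 := 𝕜) i)
    (hw : w ∈ parity (𝕜 := 𝕜) j) :
    ι 𝕜 v * ι 𝕜 w = superSign 𝕜 i j • (ι 𝕜 w * ι 𝕜 v) := by
  have h := RingQuot.mkAlgHom_rel 𝕜 (Rel.comm hv hw)
  rw [map_smul, map_mul, map_mul] at h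
  exact h

/-- The universal property of `S(V)`. -/
def lift (f : V →ₗ[𝕜] B)
    (hf : ∀ (i j : ZMod 2) (v w : V), v ∈ parity (𝕜 := 𝕜) i → w ∈ parity (𝕜 := 𝕜) j →
      f v * f w = superSign 𝕜 i j • (f w * f v)) :
    SuperSymmetric 𝕜 V →ₐ[𝕜] B :=
  RingQuot.liftAlgHom 𝕜 ⟨TensorAlgebra.lift 𝕜 f, by
    rintro _ _ ⟨hv, hw⟩
    simpa using hf _ _ _ _ hv hw⟩

theorem lift_ι (f : V →ₗ[𝕜] B)
    (hf : ∀ (i j : ZMod 2) (v w : V), v ∈ parity (𝕜 := 𝕜) i → w ∈ parity (𝕜 := 𝕜) j →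
      f v * f w = superSign 𝕜 i j • (f w * f v)) (v : V) :
    lift f hf (ι 𝕜 v) = f v := by
  have := RingQuot.liftAlgHom_mkAlgHom_apply 𝕜 (TensorAlgebra.lift 𝕜 f)
    (s := SuperSymmetric.Rel 𝕜 V) (by
      rintro _ _ ⟨hv, hw⟩
      simpa using hf _ _ _ _ hv hw) (TensorAlgebra.ι 𝕜 v)
  rw [TensorAlgebra.lift_ι_apply] at this
  exact this

/-- A subspace of `S(V)` which contains `1` and is stable under the multiplications with elements
of `V` is everything. -/
theorem eq_top_of_mul_mem {W : Submodule 𝕜 (SuperSymmetric 𝕜 V)} (h1 : 1 ∈ W)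
    (h : ∀ v : V, ∀ a ∈ W, ι 𝕜 v * a ∈ W) : W = ⊤ := by
  let mk : TensorAlgebra 𝕜 V →ₐ[𝕜] SuperSymmetric 𝕜 V := RingQuot.mkAlgHom 𝕜 (Rel 𝕜 V)
  have key : ∀ t : TensorAlgebra 𝕜 V, ∀ a ∈ W, mk t * a ∈ W := by
    intro t
    induction t using TensorAlgebra.induction with
    | algebraMap r =>
      intro a ha
      rw [AlgHom.commutes, ← Algebra.smul_def]
      exact W.smul_mem r ha
    | ι v => exact h v
    | mul s t hs ht =>
      intro a ha
      rw [map_mul, mul_assoc]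
      exact hs _ (ht _ ha)
    | add s t hs ht =>
      intro a ha
      rw [map_add, add_mul]
      exact W.add_mem (hs _ ha) (ht _ ha)
  rw [eq_top_iff]
  rintro a -
  obtain ⟨t, rfl⟩ : ∃ t, mk t = a := RingQuot.mkAlgHom_surjective 𝕜 (Rel 𝕜 V) a
  simpa using key t 1 h1

/-- The augmentation `S(V) → 𝕜`. -/
def augmentation (𝕜 V : Type*) [Field 𝕜] [AddCommGroup V] [Module 𝕜 V] [SuperModule 𝕜 V] :
    SuperSymmetric 𝕜 V →ₐ[𝕜] 𝕜 := lift 0 (by simp)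

instance : Nontrivial (SuperSymmetric 𝕜 V) := (augmentation 𝕜 V).toRingHom.domain_nontrivial

end Lift

/-! ### Parity -/

section Parity

variable {𝕜 V : Type*} [Field 𝕜] [AddCommGroup V] [Module 𝕜 V] [SuperModule 𝕜 V]

theorem one_mem_par : (1 : SuperSymmetric 𝕜 V) ∈ par 𝕜 V 0 :=
  Submodule.subset_span ⟨[], by simp, by simp, by simp⟩

theorem ι_mul_mem_par {i j : ZMod 2} {v : V} (hv : v ∈ parity (𝕜 := 𝕜) i)
    {a : SuperSymmetric 𝕜 V} (ha : a ∈ par 𝕜 V j) : ι 𝕜 v * a ∈ par 𝕜 V (i + j) := by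
  induction ha using Submodule.span_induction with
  | mem a ha =>
    obtain ⟨l, hl, rfl, rfl⟩ := ha
    exact Submodule.subset_span ⟨(i, v) :: l, List.forall_mem_cons.2 ⟨hv, hl⟩, by simp, by simp⟩
  | zero => simp
  | add a b _ _ ha hb => rw [mul_add]; exact add_mem ha hb
  | smul c a _ ha => rw [mul_smul_comm]; exact Submodule.smul_mem _ c ha

/-- A family of statements about the elements of `S(V)` of given parity may be checked on products
of homogeneous elements of `V`. -/
theorem par_le {W : ZMod 2 → Submodule 𝕜 (SuperSymmetric 𝕜 V)} (h1 : 1 ∈ W 0)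
    (h : ∀ i j : ZMod 2, ∀ v ∈ parity (𝕜 := 𝕜) (V := V) i, ∀ a ∈ W j, ι 𝕜 v * a ∈ W (i + j))
    (i : ZMod 2) : par 𝕜 V i ≤ W i := by
  refine Submodule.span_le.2 ?_
  rintro _ ⟨l, hl, rfl, rfl⟩
  induction l with
  | nil => simpa using h1
  | cons p l ih =>
    simp only [List.map_cons, List.sum_cons, List.prod_cons]
    exact h _ _ _ (hl p (by simp)) _ (ih fun q hq => hl q (by simp [hq]))

theorem one_mem_endPar : (1 : Module.End 𝕜 (SuperSymmetric 𝕜 V)) ∈ endPar 𝕜 V 0 := fun j a ha => by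
  simpa using ha

theorem mul_mem_endPar {i j : ZMod 2} {S T : Module.End 𝕜 (SuperSymmetric 𝕜 V)}
    (hS : S ∈ endPar 𝕜 V i) (hT : T ∈ endPar 𝕜 V j) : S * T ∈ endPar 𝕜 V (i + j) :=
  fun k a ha => by
    rw [add_assoc]
    exact hS _ _ (hT _ _ ha)

end Parity

end SuperSymmetric

/-! ## Homogeneous bases -/

/-- A basis of a super vector space which consists of homogeneous elements. -/
structure SuperBasis (I 𝕜 V : Type*) [Field 𝕜] [AddCommGroup V] [Module 𝕜 V]
    [SuperModule 𝕜 V] where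
  basis : Module.Basis I 𝕜 V
  deg : I → ZMod 2
  mem : ∀ i, basis i ∈ parity (𝕜 := 𝕜) (deg i)

theorem SuperModule.eq_zero_of_mem {𝕜 V : Type*} [Field 𝕜] [AddCommGroup V] [Module 𝕜 V]
    [SuperModule 𝕜 V] {i j : ZMod 2} (hij : i ≠ j) {v : V} (hi : v ∈ parity (𝕜 := 𝕜) i)
    (hj : v ∈ parity (𝕜 := 𝕜) j) : v = 0 := by
  have hd := Submodule.disjoint_def.1 (SuperModule.isCompl (𝕜 := 𝕜) (V := V)).disjoint
  fin_cases i <;> fin_cases j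
  · exact absurd rfl hij
  · exact hd v hi hj
  · exact hd v hj hi
  · exact absurd rfl hij

theorem SuperModule.eq_sup {𝕜 V : Type*} [Field 𝕜] [AddCommGroup V] [Module 𝕜 V]
    [SuperModule 𝕜 V] (v : V) : ∃ y ∈ parity (𝕜 := 𝕜) 0, ∃ z ∈ parity (𝕜 := 𝕜) 1, y + z = v :=
  Submodule.mem_sup.1 ((SuperModule.isCompl (𝕜 := 𝕜) (V := V)).sup_eq_top ▸ Submodule.mem_top)

namespace SuperBasis

variable {I 𝕜 V : Type*} [Field 𝕜] [AddCommGroup V] [Module 𝕜 V]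
  [SuperModule 𝕜 V] [Fintype I] (b : SuperBasis I 𝕜 V)

/-- The wrong-parity part `u` of the expansion of `v` is the difference of two vectors of parity
`q`, so it has both parities and vanishes. This is what lets coordinates absorb mismatched signs
throughout. -/
theorem repr_eq_zero {i : I} {q : ZMod 2} (hq : q ≠ b.deg i) {v : V}
    (hv : v ∈ parity (𝕜 := 𝕜) q) : b.basis.repr v i = 0 := by
  classical
  let w : V := ∑ j with b.deg j = q, b.basis.repr v j • b.basis j
  let u : V := ∑ j with ¬ b.deg j = q, b.basis.repr v j • b.basis j
  have hwu : w + u = v :=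
    (Finset.sum_filter_add_sum_filter_not _ _ _).trans (b.basis.sum_repr v)
  have hw : w ∈ parity (𝕜 := 𝕜) q := Submodule.sum_mem _ fun j hj =>
    Submodule.smul_mem _ _ ((Finset.mem_filter.1 hj).2 ▸ b.mem j)
  have hu : u ∈ parity (𝕜 := 𝕜) (q + 1) := Submodule.sum_mem _ fun j hj => by
    have h2 : ∀ x y : ZMod 2, ¬ x = y → x = y + 1 := by decide
    exact Submodule.smul_mem _ _ (h2 _ _ (Finset.mem_filter.1 hj).2 ▸ b.mem j)
  have hu0 : u = 0 := SuperModule.eq_zero_of_mem (i := q) (j := q + 1)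
    (by simp) (by rw [← hwu] at hv; exact (Submodule.add_mem_iff_right _ hw).1 hv) hu
  have h3 := congrArg (fun x => b.basis.repr x i) hu0
  simpa [u, Finsupp.single_apply, Finset.sum_ite, Finset.filter_filter, hq.symm] using h3

end SuperBasis

/-! ## Partial derivatives -/

namespace SuperBasis

open SuperSymmetric

variable {I 𝕜 V : Type*} [Field 𝕜] [AddCommGroup V] [Module 𝕜 V]
  [SuperModule 𝕜 V] [Fintype I] (b : SuperBasis I 𝕜 V)

/-- The automorphism of `V` which multiplies the elements of parity `q` by `(-1)^{q|i|}`. -/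
def twist (i : I) : V →ₗ[𝕜] V :=
  b.basis.constr 𝕜 fun j => superSign 𝕜 (b.deg i) (b.deg j) • b.basis j

theorem twist_apply (i : I) {q : ZMod 2} {v : V} (hv : v ∈ parity (𝕜 := 𝕜) q) :
    b.twist i v = superSign 𝕜 (b.deg i) q • v := by
  have h : b.twist i v = ∑ j, b.basis.repr v j • superSign 𝕜 (b.deg i) (b.deg j) • b.basis j := by
    conv_lhs => rw [← b.basis.sum_repr v, map_sum]
    simp only [twist, map_smul, Module.Basis.constr_basis]
  rw [h]
  conv_rhs => rw [← b.basis.sum_repr v, Finset.smul_sum]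
  refine Finset.sum_congr rfl fun j _ => ?_
  by_cases hq : q = b.deg j
  · rw [smul_comm, hq]
  · simp [b.repr_eq_zero hq hv]

/-- The linear map underlying `SuperBasis.leibnizHom`. -/
def leibnizLinear (i : I) : V →ₗ[𝕜] Matrix (Fin 2) (Fin 2) (SuperSymmetric 𝕜 V) where
  toFun v := !![ι 𝕜 (b.twist i v), algebraMap 𝕜 _ (b.basis.repr v i); 0, ι 𝕜 v]
  map_add' v w := by
    ext k l
    fin_cases k <;> fin_cases l <;> simp
  map_smul' c v := by
    ext k l
    fin_cases k <;> fin_cases l <;> simp [Algebra.smul_def]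

theorem leibnizLinear_apply (i : I) {q : ZMod 2} {v : V} (hv : v ∈ parity (𝕜 := 𝕜) q) :
    b.leibnizLinear i v = !![superSign 𝕜 (b.deg i) q • ι 𝕜 v, algebraMap 𝕜 _ (b.basis.repr v i);
      0, ι 𝕜 v] := by
  rw [← map_smul, ← b.twist_apply i hv]
  rfl

theorem mul_algebraMap_eq_smul {𝕜 A : Type*} [Field 𝕜] [Ring A] [Algebra 𝕜 A] (c : 𝕜) (a : A) :
    a * algebraMap 𝕜 A c = c • a := by
  rw [← Algebra.commutes, ← Algebra.smul_def]

/-- The algebra morphism `a ↦ (γ(a), ∂ᵢ a; 0, a)`, which encodes the Leibniz rule for `∂ᵢ`. -/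
def leibnizHom (i : I) : SuperSymmetric 𝕜 V →ₐ[𝕜] Matrix (Fin 2) (Fin 2) (SuperSymmetric 𝕜 V) :=
  lift (b.leibnizLinear i) fun p q v w hv hw => by
    have hvw := ι_mul_ι hv hw
    -- Both sign identities hold because a nonzero `i`-th coordinate forces the vector to have the
    -- parity of `bᵢ`. They are the compatibility of the upper right entry with supercommutation.
    have h1 : superSign 𝕜 (b.deg i) p * b.basis.repr w i
        = superSign 𝕜 p q * b.basis.repr w i := by
      by_cases hq : q = b.deg i
      · rw [hq, superSign_comm]
      · simp [b.repr_eq_zero hq hw]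
    have h2 : b.basis.repr v i
        = superSign 𝕜 p q * (superSign 𝕜 (b.deg i) q * b.basis.repr v i) := by
      by_cases hp : p = b.deg i
      · rw [hp, ← mul_assoc, superSign_mul_self, one_mul]
      · simp [b.repr_eq_zero hp hv]
    rw [b.leibnizLinear_apply i hv, b.leibnizLinear_apply i hw, Matrix.mul_fin_two,
      Matrix.mul_fin_two]
    ext k l
    fin_cases k <;> fin_cases l
    · simp [hvw, smul_smul, mul_comm, mul_left_comm]
    · simp only [Fin.zero_eta, Fin.mk_one, Matrix.of_apply, Matrix.cons_val', Matrix.cons_val_zero,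
        Matrix.cons_val_one, Matrix.cons_val_fin_one, Matrix.smul_apply, mul_algebraMap_eq_smul,
        ← Algebra.smul_def, smul_add, smul_smul]
      rw [add_comm, mul_comm (b.basis.repr w i), h1, mul_comm (b.basis.repr v i), ← h2]
    · simp
    · simpa using hvw

theorem leibnizHom_ι (i : I) (v : V) : b.leibnizHom i (ι 𝕜 v) = b.leibnizLinear i v :=
  lift_ι _ _ v

theorem leibnizHom_snd (i : I) (a : SuperSymmetric 𝕜 V) :
    b.leibnizHom i a 1 0 = 0 ∧ b.leibnizHom i a 1 1 = a := by
  let W : Submodule 𝕜 (SuperSymmetric 𝕜 V) :=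
    { carrier := {a | b.leibnizHom i a 1 0 = 0 ∧ b.leibnizHom i a 1 1 = a}
      add_mem' := fun {x y} hx hy => by
        simp [hx.1, hx.2, hy.1, hy.2]
      zero_mem' := by simp
      smul_mem' := fun c x hx => by simp [hx.1, hx.2] }
  have hW : W = ⊤ := eq_top_of_mul_mem (by simp [W]) fun v a ha => by
    change _ ∧ _
    rw [map_mul, leibnizHom_ι, Matrix.mul_apply, Matrix.mul_apply]
    simp [leibnizLinear, ha.1, ha.2]
  exact (hW ▸ Submodule.mem_top : a ∈ W)

/-- This diagonal entry supplies the sign in the Leibniz rule for an odd derivative. -/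
theorem leibnizHom_fst (i : I) (j : ZMod 2) {a : SuperSymmetric 𝕜 V} (ha : a ∈ par 𝕜 V j) :
    b.leibnizHom i a 0 0 = superSign 𝕜 (b.deg i) j • a := by
  let W (j : ZMod 2) : Submodule 𝕜 (SuperSymmetric 𝕜 V) :=
    { carrier := {a | b.leibnizHom i a 0 0 = superSign 𝕜 (b.deg i) j • a}
      add_mem' := fun {x y} hx hy => by
        simp only [Set.mem_ofPred_eq] at hx hy
        simp [hx, hy]
      zero_mem' := by simp
      smul_mem' := fun c x hx => by
        simp only [Set.mem_ofPred_eq] at hx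
        simp [hx, smul_comm c] }
  refine par_le (W := W) (by simp [W]) (fun q k v hv a ha => ?_) j ha
  change _ = _
  change _ = _ at ha
  rw [map_mul, leibnizHom_ι, leibnizLinear_apply _ i hv, Matrix.mul_apply]
  simp [ha, (b.leibnizHom_snd i a).1, superSign_add_right, smul_smul, mul_comm]

/-- The partial derivative `∂ᵢ` of `S(V)`. -/
def partialDeriv (i : I) : Module.End 𝕜 (SuperSymmetric 𝕜 V) where
  toFun a := b.leibnizHom i a 0 1
  map_add' a a' := by simp
  map_smul' c a := by simp

/-- The multiplication with the basis vector `bᵢ`. -/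
def mulBasis (i : I) : Module.End 𝕜 (SuperSymmetric 𝕜 V) := LinearMap.mulLeft 𝕜 (ι 𝕜 (b.basis i))

@[simp]
theorem mulBasis_apply (i : I) (a : SuperSymmetric 𝕜 V) :
    b.mulBasis i a = ι 𝕜 (b.basis i) * a := rfl

theorem partialDeriv_mul (i : I) {j : ZMod 2} {a : SuperSymmetric 𝕜 V} (ha : a ∈ par 𝕜 V j)
    (a' : SuperSymmetric 𝕜 V) :
    b.partialDeriv i (a * a')
      = b.partialDeriv i a * a' + superSign 𝕜 (b.deg i) j • (a * b.partialDeriv i a') := by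
  change b.leibnizHom i (a * a') 0 1 = b.leibnizHom i a 0 1 * a' + superSign 𝕜 (b.deg i) j •
    (a * b.leibnizHom i a' 0 1)
  rw [map_mul, Matrix.mul_apply, Fin.sum_univ_two, b.leibnizHom_fst i j ha,
    (b.leibnizHom_snd i a').2, add_comm, smul_mul_assoc]

@[simp]
theorem partialDeriv_one (i : I) : b.partialDeriv i 1 = 0 := by
  change b.leibnizHom i 1 0 1 = 0
  simp

theorem partialDeriv_ι (i : I) (v : V) :
    b.partialDeriv i (ι 𝕜 v) = algebraMap 𝕜 _ (b.basis.repr v i) := by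
  change b.leibnizHom i (ι 𝕜 v) 0 1 = _
  rw [leibnizHom_ι]
  rfl

theorem ι_mem_par {q : ZMod 2} {v : V} (hv : v ∈ parity (𝕜 := 𝕜) q) : ι 𝕜 v ∈ par 𝕜 V q := by
  simpa using ι_mul_mem_par hv one_mem_par

theorem partialDeriv_ι_mul (i : I) {q : ZMod 2} {v : V} (hv : v ∈ parity (𝕜 := 𝕜) q)
    (a : SuperSymmetric 𝕜 V) :
    b.partialDeriv i (ι 𝕜 v * a) = b.basis.repr v i • a
      + superSign 𝕜 (b.deg i) q • (ι 𝕜 v * b.partialDeriv i a) := by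
  rw [b.partialDeriv_mul i (ι_mem_par hv), partialDeriv_ι, ← Algebra.smul_def]

theorem partialDeriv_mem_endPar (i : I) : b.partialDeriv i ∈ endPar 𝕜 V (b.deg i) := by
  intro j a ha
  -- The parity of `a` itself is carried along, since the Leibniz rule returns a multiple of `a` as
  -- well as a multiple of its derivative.
  refine par_le (W := fun j => (par 𝕜 V (b.deg i + j)).comap (b.partialDeriv i) ⊓ par 𝕜 V j)
    ?_ (fun q k v hv a ha => ?_) j ha |>.1
  · exact ⟨by simp, one_mem_par⟩
  · refine ⟨?_, ι_mul_mem_par hv ha.2⟩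
    change b.partialDeriv i _ ∈ par 𝕜 V _
    rw [b.partialDeriv_ι_mul i hv]
    refine add_mem ?_ (Submodule.smul_mem _ _ ?_)
    · by_cases hq : q = b.deg i
      · refine Submodule.smul_mem _ _ ?_
        have h2 : ∀ x y : ZMod 2, x + (x + y) = y := by decide
        rw [hq, h2]
        exact ha.2
      · simp [b.repr_eq_zero hq hv]
    · rw [add_left_comm]
      exact ι_mul_mem_par hv ha.1

theorem mulBasis_mem_endPar (i : I) : b.mulBasis i ∈ endPar 𝕜 V (b.deg i) :=
  fun _ _ ha => ι_mul_mem_par (b.mem i) ha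

theorem isSuperDerivation_partialDeriv (i : I) :
    IsSuperDerivation 𝕜 (b.deg i) (b.partialDeriv i) :=
  ⟨b.partialDeriv_mem_endPar i, fun _ _ ha a' => b.partialDeriv_mul i ha a'⟩

theorem partialDeriv_mem_partials (i : I) : b.partialDeriv i ∈ partials 𝕜 V :=
  Submodule.subset_span ⟨⟨_, b.isSuperDerivation_partialDeriv i⟩, fun v => ⟨_, b.partialDeriv_ι i v⟩⟩

/-- The products of basis vectors span `S(V)`. -/
theorem eq_top_of_mulBasis_mem {W : Submodule 𝕜 (SuperSymmetric 𝕜 V)} (h1 : 1 ∈ W)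
    (h : ∀ i, ∀ a ∈ W, b.mulBasis i a ∈ W) : W = ⊤ := by
  refine eq_top_of_mul_mem h1 fun v a ha => ?_
  rw [← b.basis.sum_repr v, map_sum, Finset.sum_mul]
  refine Submodule.sum_mem _ fun i _ => ?_
  rw [map_smul, smul_mul_assoc]
  exact W.smul_mem _ (h i a ha)

/-! ### The relations of the Weyl superalgebra -/

variable [DecidableEq I]

theorem partialDeriv_mul_mulBasis (i j : I) :
    b.partialDeriv i * b.mulBasis j = (if i = j then 1 else 0)
      + superSign 𝕜 (b.deg i) (b.deg j) • (b.mulBasis j * b.partialDeriv i) := by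
  ext a
  have := b.partialDeriv_ι_mul i (b.mem j) a
  rw [b.basis.repr_self_apply] at this
  simp only [Module.End.mul_apply, mulBasis_apply, LinearMap.add_apply, LinearMap.smul_apply, this]
  by_cases h : i = j
  · simp [h]
  · simp [h, Ne.symm h]

/-- The kernel of the difference contains `1` and is stable under multiplication by basis vectors:
pushing both derivatives past `bₖ` produces Kronecker terms that match after the signs are compared.
-/
theorem partialDeriv_mul_partialDeriv (i j : I) :
    b.partialDeriv i * b.partialDeriv j
      = superSign 𝕜 (b.deg i) (b.deg j) • (b.partialDeriv j * b.partialDeriv i) := by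
  rw [← sub_eq_zero]
  refine LinearMap.ker_eq_top.1 (b.eq_top_of_mulBasis_mem (by simp) fun k a ha => ?_)
  have h (i j : I) (a : SuperSymmetric 𝕜 V) : b.partialDeriv i (b.mulBasis j a)
      = (if i = j then (1 : 𝕜) else 0) • a
        + superSign 𝕜 (b.deg i) (b.deg j) • b.mulBasis j (b.partialDeriv i a) := by
    have := LinearMap.congr_fun (b.partialDeriv_mul_mulBasis i j) a
    split_ifs at this ⊢ <;> simpa using this
  rw [LinearMap.mem_ker] at ha ⊢
  simp only [LinearMap.sub_apply, Module.End.mul_apply, LinearMap.smul_apply, sub_eq_zero] at ha ⊢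
  simp only [h, map_add, map_smul, ha]
  have h1 : (if j = k then (1 : 𝕜) else 0) = superSign 𝕜 (b.deg i) (b.deg j)
      * (superSign 𝕜 (b.deg i) (b.deg k) * (if j = k then (1 : 𝕜) else 0)) := by
    split_ifs with hjk
    · simp [hjk]
    · simp
  have h2 : superSign 𝕜 (b.deg j) (b.deg k) * (if i = k then (1 : 𝕜) else 0)
      = superSign 𝕜 (b.deg i) (b.deg j) * (if i = k then (1 : 𝕜) else 0) := by
    split_ifs with hik
    · rw [hik, superSign_comm]
    · simp
  simp only [smul_add, smul_smul]
  rw [h2, ← h1]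
  rw [show superSign 𝕜 (b.deg j) (b.deg k)
      * (superSign 𝕜 (b.deg i) (b.deg k) * superSign 𝕜 (b.deg i) (b.deg j))
    = superSign 𝕜 (b.deg i) (b.deg j)
      * (superSign 𝕜 (b.deg i) (b.deg k) * superSign 𝕜 (b.deg j) (b.deg k)) by ring]
  abel

end SuperBasis

/-! ## The Euler operator and the grading of `S(V)` -/

namespace SuperSymmetric

/-- The homogeneous component `Sⁿ(V)`. -/
def homog (𝕜 V : Type*) [Field 𝕜] [AddCommGroup V] [Module 𝕜 V] [SuperModule 𝕜 V] (n : ℕ) :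
    Submodule 𝕜 (SuperSymmetric 𝕜 V) := LinearMap.range (ι 𝕜 (V := V)) ^ n

/-- The filtration `S^{≤ n}(V)`. -/
def filt (𝕜 V : Type*) [Field 𝕜] [AddCommGroup V] [Module 𝕜 V] [SuperModule 𝕜 V] (n : ℕ) :
    Submodule 𝕜 (SuperSymmetric 𝕜 V) := ⨆ k ∈ Finset.range (n + 1), homog 𝕜 V k

variable {𝕜 V : Type*} [Field 𝕜] [AddCommGroup V] [Module 𝕜 V] [SuperModule 𝕜 V]

theorem one_mem_homog : 1 ∈ homog 𝕜 V 0 := by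
  rw [homog, pow_zero]
  exact Submodule.one_le.1 le_rfl

theorem mem_homog_zero {a : SuperSymmetric 𝕜 V} (ha : a ∈ homog 𝕜 V 0) :
    ∃ c : 𝕜, c • 1 = a := by
  rw [homog, pow_zero, Submodule.mem_one] at ha
  obtain ⟨c, rfl⟩ := ha
  exact ⟨c, by rw [Algebra.algebraMap_eq_smul_one]⟩

theorem ι_mul_mem_homog (v : V) {n : ℕ} {a : SuperSymmetric 𝕜 V} (ha : a ∈ homog 𝕜 V n) :
    ι 𝕜 v * a ∈ homog 𝕜 V (n + 1) := by
  rw [homog, pow_succ']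
  exact Submodule.mul_mem_mul ⟨v, rfl⟩ ha

/-- Induction on the degree: `S^{n+1}(V)` is spanned by the products `v a` with `a ∈ Sⁿ(V)`. -/
theorem homog_succ_le {W : Submodule 𝕜 (SuperSymmetric 𝕜 V)} {n : ℕ}
    (h : ∀ v : V, ∀ a ∈ homog 𝕜 V n, ι 𝕜 v * a ∈ W) : homog 𝕜 V (n + 1) ≤ W := by
  rw [homog, pow_succ', Submodule.mul_le]
  rintro _ ⟨v, rfl⟩ a ha
  exact h v a ha

theorem iSup_homog : ⨆ n, homog 𝕜 V n = ⊤ := by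
  refine eq_top_of_mul_mem (Submodule.mem_iSup_of_mem 0 one_mem_homog) fun v a ha => ?_
  induction ha using Submodule.iSup_induction' with
  | mem n a ha => exact Submodule.mem_iSup_of_mem (n + 1) (ι_mul_mem_homog v ha)
  | zero => simp
  | add a a' _ _ h h' => rw [mul_add]; exact add_mem h h'

theorem homog_le_filt {k n : ℕ} (h : k ≤ n) : homog 𝕜 V k ≤ filt 𝕜 V n :=
  le_iSup₂_of_le k (Finset.mem_range.2 (by omega)) le_rfl

theorem filt_le {n : ℕ} {W : Submodule 𝕜 (SuperSymmetric 𝕜 V)}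
    (h : ∀ k ≤ n, homog 𝕜 V k ≤ W) : filt 𝕜 V n ≤ W :=
  iSup₂_le fun k hk => h k (by have := Finset.mem_range.1 hk; omega)

theorem filt_mono {m n : ℕ} (h : m ≤ n) : filt 𝕜 V m ≤ filt 𝕜 V n :=
  filt_le fun _ hk => homog_le_filt (hk.trans h)

/-- Linear maps on `S(V)` which agree on the homogeneous components are equal. -/
theorem linearMap_ext {M : Type*} [AddCommGroup M] [Module 𝕜 M]
    {f f' : SuperSymmetric 𝕜 V →ₗ[𝕜] M} (h : ∀ n, ∀ a ∈ homog 𝕜 V n, f a = f' a) : f = f' := by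
  rw [← sub_eq_zero, ← LinearMap.ker_eq_top, eq_top_iff, ← iSup_homog]
  exact iSup_le fun n a ha => by simp [h n a ha]

end SuperSymmetric

namespace SuperBasis

open SuperSymmetric

variable {I 𝕜 V : Type*} [Field 𝕜] [AddCommGroup V] [Module 𝕜 V]
  [SuperModule 𝕜 V] [Fintype I] (b : SuperBasis I 𝕜 V)

theorem ι_mul_eq_sum (v : V) (a : SuperSymmetric 𝕜 V) :
    ι 𝕜 v * a = ∑ i, b.basis.repr v i • b.mulBasis i a := by
  conv_lhs => rw [← b.basis.sum_repr v, map_sum, Finset.sum_mul]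
  exact Finset.sum_congr rfl fun i _ => by rw [map_smul, smul_mul_assoc]; rfl

theorem homog_succ_le_of_mulBasis {W : Submodule 𝕜 (SuperSymmetric 𝕜 V)} {n : ℕ}
    (h : ∀ i, ∀ a ∈ homog 𝕜 V n, b.mulBasis i a ∈ W) : homog 𝕜 V (n + 1) ≤ W :=
  homog_succ_le fun v a ha => by
    rw [b.ι_mul_eq_sum]
    exact Submodule.sum_mem _ fun i _ => W.smul_mem _ (h i a ha)

theorem mulBasis_mem_homog (i : I) {n : ℕ} {a : SuperSymmetric 𝕜 V} (ha : a ∈ homog 𝕜 V n) :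
    b.mulBasis i a ∈ homog 𝕜 V (n + 1) := ι_mul_mem_homog _ ha

theorem partialDeriv_homog_zero (i : I) {a : SuperSymmetric 𝕜 V} (ha : a ∈ homog 𝕜 V 0) :
    b.partialDeriv i a = 0 := by
  obtain ⟨c, rfl⟩ := mem_homog_zero ha
  simp

variable [DecidableEq I]

theorem partialDeriv_mulBasis (i j : I) (a : SuperSymmetric 𝕜 V) :
    b.partialDeriv i (b.mulBasis j a) = (if i = j then a else 0)
      + superSign 𝕜 (b.deg i) (b.deg j) • b.mulBasis j (b.partialDeriv i a) := by
  have := LinearMap.congr_fun (b.partialDeriv_mul_mulBasis i j) a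
  split_ifs at this ⊢ <;> simpa using this

theorem partialDeriv_mem_homog (i : I) {n : ℕ} {a : SuperSymmetric 𝕜 V}
    (ha : a ∈ homog 𝕜 V (n + 1)) : b.partialDeriv i a ∈ homog 𝕜 V n := by
  induction n generalizing a with
  | zero =>
    refine b.homog_succ_le_of_mulBasis (W := (homog 𝕜 V 0).comap (b.partialDeriv i))
      (fun j a ha => ?_) ha
    rw [Submodule.mem_comap, partialDeriv_mulBasis, b.partialDeriv_homog_zero i ha]
    split_ifs <;> simp [ha]
  | succ n ih =>
    refine b.homog_succ_le_of_mulBasis (W := (homog 𝕜 V (n + 1)).comap (b.partialDeriv i))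
      (fun j a ha => ?_) ha
    rw [Submodule.mem_comap, partialDeriv_mulBasis]
    refine add_mem ?_ (Submodule.smul_mem _ _ (b.mulBasis_mem_homog j (ih ha)))
    split_ifs <;> simp [ha]

/-- The Euler operator `∑ᵢ bᵢ ∂ᵢ`. -/
def euler : Module.End 𝕜 (SuperSymmetric 𝕜 V) :=
  ∑ i, b.mulBasis i * b.partialDeriv i

/-- The signs from moving `bⱼ` past `∂ᵢ` and past `bᵢ` are equal and cancel; the Kronecker term
contributes the extra `bⱼ`. -/
theorem euler_mul_mulBasis (j : I) : b.euler * b.mulBasis j = b.mulBasis j * (b.euler + 1) := by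
  have hcomm (i : I) : b.mulBasis i * b.mulBasis j
      = superSign 𝕜 (b.deg i) (b.deg j) • (b.mulBasis j * b.mulBasis i) := by
    ext a
    simp only [Module.End.mul_apply, mulBasis_apply, LinearMap.smul_apply, ← mul_assoc,
      ι_mul_ι (b.mem i) (b.mem j), smul_mul_assoc]
  rw [euler, Finset.sum_mul, mul_add, Finset.mul_sum]
  have h (i : I) : b.mulBasis i * b.partialDeriv i * b.mulBasis j
      = b.mulBasis j * (b.mulBasis i * b.partialDeriv i)
        + (if i = j then b.mulBasis i else 0) := by
    rw [mul_assoc, partialDeriv_mul_mulBasis, mul_add, mul_smul_comm, ← mul_assoc, hcomm,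
      smul_mul_assoc, smul_smul, superSign_mul_self, one_smul, mul_assoc, add_comm]
    split_ifs <;> simp
  simp [h, Finset.sum_add_distrib]

theorem euler_apply {n : ℕ} {a : SuperSymmetric 𝕜 V} (ha : a ∈ homog 𝕜 V n) :
    b.euler a = (n : 𝕜) • a := by
  induction n generalizing a with
  | zero => simp [euler, b.partialDeriv_homog_zero _ ha]
  | succ n ih =>
    suffices h : a ∈ LinearMap.ker (b.euler - ((n + 1 : ℕ) : 𝕜) • LinearMap.id) by
      simpa [sub_eq_zero] using h
    refine b.homog_succ_le_of_mulBasis (fun j a ha => ?_) ha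
    have := LinearMap.congr_fun (b.euler_mul_mulBasis j) a
    simp only [Module.End.mul_apply, LinearMap.add_apply, ih ha, map_add, map_smul,
      Module.End.one_apply] at this
    simp only [LinearMap.mem_ker, LinearMap.sub_apply, this, LinearMap.smul_apply,
      LinearMap.id_apply]
    push_cast
    module

/-- `S(V)` is the direct sum of its homogeneous components. -/
theorem isInternal_homog (b : SuperBasis I 𝕜 V) [CharZero 𝕜] : DirectSum.IsInternal (homog 𝕜 V) := by
  refine DirectSum.isInternal_submodule_of_iSupIndep_of_iSup_eq_top ?_ iSup_homog
  -- The components lie in eigenspaces of the Euler operator for the eigenvalues `n`, which are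
  -- distinct in characteristic zero.
  refine ((Module.End.eigenspaces_iSupIndep b.euler).comp
    (Nat.cast_injective (R := 𝕜))).mono fun n a ha => ?_
  exact Module.End.mem_eigenspace_iff.2 (b.euler_apply ha)

theorem bijective_homog (b : SuperBasis I 𝕜 V) [CharZero 𝕜] :
    Function.Bijective (DirectSum.coeLinearMap (homog 𝕜 V)) := b.isInternal_homog

/-- The linear map on `S(V)` which agrees with `L n` on `Sⁿ(V)`. -/
def glue [CharZero 𝕜] {M : Type*} [AddCommGroup M] [Module 𝕜 M]
    (L : ℕ → SuperSymmetric 𝕜 V →ₗ[𝕜] M) : SuperSymmetric 𝕜 V →ₗ[𝕜] M :=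
  DirectSum.toModule 𝕜 ℕ M (fun n => L n ∘ₗ (homog 𝕜 V n).subtype) ∘ₗ
    (LinearEquiv.ofBijective (DirectSum.coeLinearMap (homog 𝕜 V))
      b.bijective_homog).symm.toLinearMap

theorem glue_apply [CharZero 𝕜] {M : Type*} [AddCommGroup M] [Module 𝕜 M]
    (L : ℕ → SuperSymmetric 𝕜 V →ₗ[𝕜] M) {n : ℕ} {a : SuperSymmetric 𝕜 V}
    (ha : a ∈ homog 𝕜 V n) : b.glue L a = L n a := by
  have h : (LinearEquiv.ofBijective (DirectSum.coeLinearMap (homog 𝕜 V)) b.bijective_homog).symm a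
      = DirectSum.lof 𝕜 ℕ (fun n => homog 𝕜 V n) n ⟨a, ha⟩ := by
    rw [LinearEquiv.symm_apply_eq]
    simp
  simp only [glue, LinearMap.comp_apply, LinearEquiv.coe_coe, h, DirectSum.toModule_lof]
  rfl

end SuperBasis

/-! ## The coefficients of the fundamental vector fields -/

/-- A vector space complement, with basis `e` and coordinates `c`, of the subalgebra
`k = ⋂ᵢ ker cᵢ` of `g`, together with a linear form `lam` which vanishes on the complement and
on `[k, k]`. -/
structure InducingDatum (I 𝕜 g : Type*) [DecidableEq I] [Field 𝕜] [AddCommGroup g]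
    [Module 𝕜 g] [LieSuperalgebra 𝕜 g] where
  e : I → g
  c : I → g →ₗ[𝕜] 𝕜
  lam : g →ₗ[𝕜] 𝕜
  c_e : ∀ i j, c i (e j) = if i = j then 1 else 0
  lam_e : ∀ i, lam (e i) = 0
  c_br : ∀ x y, (∀ i, c i x = 0) → (∀ i, c i y = 0) → ∀ i, c i (br (𝕜 := 𝕜) x y) = 0
  lam_br : ∀ x y, (∀ i, c i x = 0) → (∀ i, c i y = 0) → lam (br (𝕜 := 𝕜) x y) = 0

/-! ### Words in graded generators -/

/-- The span of the words of length `k` and degree `γ` in the elements `D i` of degree `deg i`. -/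
def words (𝕜 : Type*) {I A Γ : Type*} [Field 𝕜] [Ring A] [Algebra 𝕜 A] [AddCommGroup Γ]
    (D : I → A) (deg : I → Γ) (k : ℕ) (γ : Γ) : Submodule 𝕜 A :=
  Submodule.span 𝕜 {x | ∃ l : List I, l.length = k ∧ (l.map deg).sum = γ ∧ x = (l.map D).prod}

section Words

variable {𝕜 I A Γ : Type*} [Field 𝕜] [Ring A] [Algebra 𝕜 A] [AddCommGroup Γ]
    {D : I → A} {deg : I → Γ}

theorem one_mem_words : (1 : A) ∈ words 𝕜 D deg 0 0 :=
  Submodule.subset_span ⟨[], rfl, rfl, rfl⟩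

theorem mem_words (i : I) : D i ∈ words 𝕜 D deg 1 (deg i) :=
  Submodule.subset_span ⟨[i], rfl, by simp, by simp⟩

theorem mul_mem_words {k k' k'' : ℕ} {γ γ' γ'' : Γ} {x y : A} (hx : x ∈ words 𝕜 D deg k γ)
    (hy : y ∈ words 𝕜 D deg k' γ') (hk : k + k' = k'') (hγ : γ + γ' = γ'') :
    x * y ∈ words 𝕜 D deg k'' γ'' := by
  subst hk hγ
  have h : x * y ∈ words 𝕜 D deg k γ * words 𝕜 D deg k' γ' := Submodule.mul_mem_mul hx hy
  rw [words, words, Submodule.span_mul_span] at h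
  refine Submodule.span_mono ?_ h
  rintro _ ⟨_, ⟨l, rfl, rfl, rfl⟩, _, ⟨l', rfl, rfl, rfl⟩, rfl⟩
  exact ⟨l ++ l', by simp, by simp, by simp⟩

/-- The words in elements of a submodule `P` lie in the powers of `P`. -/
theorem words_le_pow {P : Submodule 𝕜 A} (hD : ∀ i, D i ∈ P) (k : ℕ) (γ : Γ) :
    words 𝕜 D deg k γ ≤ P ^ k := by
  refine Submodule.span_le.2 ?_
  rintro _ ⟨l, rfl, rfl, rfl⟩
  induction l with
  | nil => simpa using Submodule.one_le.1 (le_refl (1 : Submodule 𝕜 A))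
  | cons i l ih =>
    rw [List.map_cons, List.prod_cons, List.length_cons, pow_succ']
    exact Submodule.mul_mem_mul (hD i) ih

theorem words_le_toSubmodule {P : Subalgebra 𝕜 A} (hD : ∀ i, D i ∈ P) (k : ℕ) (γ : Γ) :
    words 𝕜 D deg k γ ≤ Subalgebra.toSubmodule P := by
  refine Submodule.span_le.2 ?_
  rintro _ ⟨l, rfl, rfl, rfl⟩
  refine Subalgebra.list_prod_mem _ fun x hx => ?_
  obtain ⟨i, _, rfl⟩ := List.mem_map.1 hx
  exact hD i

/-- There are no long words of bounded degree if all degrees are positive. -/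
theorem words_eq_bot {D : I → A} {deg : I → ℤ} (hdeg : ∀ i, deg i < 0) {k : ℕ} {γ : ℤ}
    (h : -γ < k) : words 𝕜 D deg k γ = ⊥ := by
  refine Submodule.span_eq_bot.2 ?_
  rintro _ ⟨l, rfl, rfl, rfl⟩
  exfalso
  have key : ∀ l : List I, (l.map deg).sum ≤ -l.length := fun l => by
    induction l with
    | nil => simp
    | cons i l ih =>
      have := hdeg i
      simp only [List.map_cons, List.sum_cons, List.length_cons]
      push_cast
      omega
  have := key l
  omega

/-- Words in supercommuting elements supercommute. -/
theorem mul_of_mem_words {deg : I → ZMod 2}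
    (hD : ∀ i j, D i * D j = superSign 𝕜 (deg i) (deg j) • (D j * D i)) (i : I) {k : ℕ}
    {q : ZMod 2} {x : A} (hx : x ∈ words 𝕜 D deg k q) :
    D i * x = superSign 𝕜 (deg i) q • (x * D i) := by
  induction hx using Submodule.span_induction with
  | mem x hx =>
    obtain ⟨l, rfl, rfl, rfl⟩ := hx
    induction l with
    | nil => simp
    | cons j l ih =>
      simp only [List.map_cons, List.prod_cons, List.sum_cons]
      rw [← mul_assoc, hD, smul_mul_assoc, mul_assoc, ih, superSign_add_right, mul_smul_comm,
        smul_smul, mul_assoc]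
  | zero => simp
  | add x y _ _ hx hy => rw [mul_add, hx, hy, add_mul, smul_add]
  | smul c x _ hx => rw [mul_smul_comm, hx, smul_mul_assoc, smul_comm]

end Words

/-! ### Solving the recursion for the coefficients -/

namespace InducingDatum

variable {I 𝕜 g A : Type*} [DecidableEq I] [Fintype I] [Field 𝕜] [AddCommGroup g]
    [Module 𝕜 g] [LieSuperalgebra 𝕜 g] [Ring A] [Algebra 𝕜 A] (d : InducingDatum I 𝕜 g)
    (D : I → A)

/-- The projection of `g` onto the complement, along the subalgebra. -/
def proj : g →ₗ[𝕜] g := ∑ i, (d.c i).smulRight (d.e i)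

theorem proj_apply (x : g) : d.proj x = ∑ i, d.c i x • d.e i := by simp [proj]

@[simp]
theorem c_proj (i : I) (x : g) : d.c i (d.proj x) = d.c i x := by simp [proj_apply, d.c_e]

@[simp]
theorem lam_proj (x : g) : d.lam (d.proj x) = 0 := by simp [proj_apply, d.lam_e]

@[simp]
theorem proj_e (i : I) : d.proj (d.e i) = d.e i := by simp [proj_apply, d.c_e]

@[simp]
theorem proj_proj (x : g) : d.proj (d.proj x) = d.proj x := by simp [d.proj_apply (d.proj x),
  ← d.proj_apply x]

/-- The inhomogeneous term in the recursion for the coefficients. -/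
def rhs (F : ℕ → Option I → g →ₗ[𝕜] A) (k : ℕ) (j : Option I) : g →ₗ[𝕜] A :=
  ∑ i, (LinearMap.mulRight 𝕜 (D i) ∘ₗ F k j ∘ₗ (br (𝕜 := 𝕜) (g := g)).flip (d.e i)
    - ∑ l : Fin k, LinearMap.mulLeft 𝕜 (F (l + 1) j (d.e i)) ∘ₗ F (k - l) (some i))

/-- The homogeneous parts of the coefficients of the vector field on the complement which
corresponds to `x ∈ g`, as polynomials in the symbols `D i`. The index `none` stands for the
function which has to be added to the vector field. -/
def coeff : ℕ → Option I → g →ₗ[𝕜] A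
  | 0, j => Algebra.linearMap 𝕜 A ∘ₗ j.elim d.lam d.c
  | k + 1, j =>
    let B : g →ₗ[𝕜] A := ∑ i, (LinearMap.mulRight 𝕜 (D i) ∘ₗ coeff k j ∘ₗ
        (br (𝕜 := 𝕜) (g := g)).flip (d.e i)
      - ∑ l : Fin k, LinearMap.mulLeft 𝕜 (coeff (l + 1) j (d.e i)) ∘ₗ coeff (k - l) (some i))
    -- This solves `(k + 1) F + F ∘ proj = B` for `F`: since `proj` is idempotent, the inverse of
    -- `(k + 1) + proj` is `(k + 1)⁻¹ (1 - (k + 2)⁻¹ proj)`.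
    (k + 1 : 𝕜)⁻¹ • (B - (k + 2 : 𝕜)⁻¹ • (B ∘ₗ d.proj))

theorem coeff_zero_some (i : I) (x : g) : d.coeff D 0 (some i) x = algebraMap 𝕜 A (d.c i x) := by
  rw [coeff]; rfl

theorem coeff_zero_none (x : g) : d.coeff D 0 none x = algebraMap 𝕜 A (d.lam x) := by
  rw [coeff]; rfl

theorem coeff_succ (k : ℕ) (j : Option I) (x : g) :
    d.coeff D (k + 1) j x = (k + 1 : 𝕜)⁻¹ • (d.rhs D (d.coeff D) k j x
      - (k + 2 : 𝕜)⁻¹ • d.rhs D (d.coeff D) k j (d.proj x)) := by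
  rw [coeff]
  rfl

theorem rhs_apply (F : ℕ → Option I → g →ₗ[𝕜] A) (k : ℕ) (j : Option I) (x : g) :
    d.rhs D F k j x = ∑ i, (F k j (br (𝕜 := 𝕜) x (d.e i)) * D i
      - ∑ l ∈ Finset.range k, F (l + 1) j (d.e i) * F (k - l) (some i) x) := by
  simp [rhs, Finset.sum_range]

variable [CharZero 𝕜]

theorem coeff_rec (k : ℕ) (j : Option I) (x : g) :
    (k + 1 : 𝕜) • d.coeff D (k + 1) j x + d.coeff D (k + 1) j (d.proj x)
      = d.rhs D (d.coeff D) k j x := by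
  have h1 : (k + 1 : 𝕜) ≠ 0 := by exact_mod_cast k.succ_ne_zero
  have h2 : (k + 2 : 𝕜) ≠ 0 := by exact_mod_cast (k + 1).succ_ne_zero
  rw [coeff_succ, coeff_succ, proj_proj]
  match_scalars
  · field_simp
  · field_simp
    ring

/-- The equation satisfied by the coefficients. -/
theorem coeff_eq (k : ℕ) (j : Option I) (x : g) :
    (k : 𝕜) • d.coeff D k j x - (if j = none then 0 else d.coeff D k j x)
      = ∑ i, ((if k = 0 then 0 else d.coeff D (k - 1) j (br (𝕜 := 𝕜) x (d.e i)) * D i)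
        - ∑ l ∈ Finset.HasAntidiagonal.antidiagonal k, d.coeff D l.1 j (d.e i) * d.coeff D l.2 (some i) x) := by
  -- The two ends of the convolution are special. The end `l.1 = 0` is cancelled by the correction
  -- term on the left, because degree zero coefficients are coordinates and `lam` vanishes on the
  -- complement.
  have h0 : ∀ k, ∑ i, d.coeff D 0 j (d.e i) * d.coeff D k (some i) x
      = if j = none then 0 else d.coeff D k j x := by
    intro k
    cases j with
    | none => simp [coeff_zero_none, d.lam_e]
    | some j => simp [coeff_zero_some, d.c_e, Finset.sum_ite_eq]
  cases k with
  | zero => simp [h0]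
  | succ k =>
    -- The other end produces the coefficient of the projected element, which is the second term of
    -- the recursion.
    have h1 : ∑ i, d.coeff D (k + 1) j (d.e i) * d.coeff D 0 (some i) x
        = d.coeff D (k + 1) j (d.proj x) := by
      simp [coeff_zero_some, proj_apply, SuperBasis.mul_algebraMap_eq_smul]
    have h2 := d.coeff_rec D k j x
    rw [rhs_apply] at h2
    have h3 : ∀ i, ∑ l ∈ Finset.HasAntidiagonal.antidiagonal (k + 1),
        d.coeff D l.1 j (d.e i) * d.coeff D l.2 (some i) x
        = d.coeff D 0 j (d.e i) * d.coeff D (k + 1) (some i) x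
          + ∑ l ∈ Finset.range k, d.coeff D (l + 1) j (d.e i) * d.coeff D (k - l) (some i) x
          + d.coeff D (k + 1) j (d.e i) * d.coeff D 0 (some i) x := by
      intro i
      rw [Finset.Nat.sum_antidiagonal_eq_sum_range_succ
        (fun l l' => d.coeff D l j (d.e i) * d.coeff D l' (some i) x), Finset.sum_range_succ,
        Finset.sum_range_succ']
      simp only [Nat.add_sub_add_right, Nat.sub_zero, Nat.sub_self]
      abel
    simp only [h3, Nat.add_sub_cancel, Nat.succ_ne_zero, if_false, Finset.sum_sub_distrib,
      Finset.sum_add_distrib, h0, h1] at h2 ⊢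
    rw [← eq_sub_iff_add_eq] at h2
    push_cast
    rw [h2]
    abel

/-- A grading of the Lie superalgebra which is compatible with the complement. -/
structure IsGradedBy {Γ : Type*} [AddCommGroup Γ] (𝒢 : Γ → Submodule 𝕜 g) (deg : I → Γ) :
    Prop where
  e_mem : ∀ i, d.e i ∈ 𝒢 (deg i)
  br_mem : ∀ γ δ, ∀ x ∈ 𝒢 γ, ∀ y ∈ 𝒢 δ, br (𝕜 := 𝕜) x y ∈ 𝒢 (γ + δ)
  c_eq_zero : ∀ γ i, γ ≠ deg i → ∀ x ∈ 𝒢 γ, d.c i x = 0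
  lam_eq_zero : ∀ γ, γ ≠ 0 → ∀ x ∈ 𝒢 γ, d.lam x = 0

variable {d} in
theorem IsGradedBy.proj_mem {Γ : Type*} [AddCommGroup Γ] {𝒢 : Γ → Submodule 𝕜 g} {deg : I → Γ}
    (h : d.IsGradedBy 𝒢 deg) {γ : Γ} {x : g} (hx : x ∈ 𝒢 γ) : d.proj x ∈ 𝒢 γ := by
  rw [proj_apply]
  refine Submodule.sum_mem _ fun i _ => ?_
  by_cases hi : γ = deg i
  · exact Submodule.smul_mem _ _ (hi ▸ h.e_mem i)
  · simp [h.c_eq_zero γ i hi x hx]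

variable {d} in
/-- The coefficients are homogeneous. -/
theorem IsGradedBy.coeff_mem {Γ : Type*} [AddCommGroup Γ] {𝒢 : Γ → Submodule 𝕜 g} {deg : I → Γ}
    (h : d.IsGradedBy 𝒢 deg) (k : ℕ) (j : Option I) {γ : Γ} {x : g} (hx : x ∈ 𝒢 γ) :
    d.coeff D k j x ∈ words 𝕜 D deg k (j.elim 0 deg - γ) := by
  induction k using Nat.strong_induction_on generalizing j γ x with
  | _ k ih =>
    cases k with
    | zero =>
      cases j with
      | none =>
        rw [coeff_zero_none]
        by_cases hγ : γ = 0
        · rw [Algebra.algebraMap_eq_smul_one]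
          refine Submodule.smul_mem _ _ ?_
          simpa [hγ] using one_mem_words
        · simp [h.lam_eq_zero γ hγ x hx]
      | some j =>
        rw [coeff_zero_some]
        by_cases hγ : γ = deg j
        · rw [Algebra.algebraMap_eq_smul_one]
          refine Submodule.smul_mem _ _ ?_
          simpa [hγ] using one_mem_words
        · simp [h.c_eq_zero γ j hγ x hx]
    | succ k =>
      -- The degree of `e i` cancels in both kinds of term: it is lost through the bracket and
      -- regained from `D i`, or it occurs with opposite signs in the two factors.
      have hB {γ : Γ} {x : g} (hx : x ∈ 𝒢 γ) :
          d.rhs D (d.coeff D) k j x ∈ words 𝕜 D deg (k + 1) (j.elim 0 deg - γ) := by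
        rw [rhs_apply]
        refine Submodule.sum_mem _ fun i _ => sub_mem ?_ (Submodule.sum_mem _ fun l hl => ?_)
        · exact mul_mem_words (ih k (by omega) j (h.br_mem _ _ _ hx _ (h.e_mem i)))
            (mem_words i) rfl (by abel)
        · have hl' := Finset.mem_range.1 hl
          exact mul_mem_words (ih (l + 1) (by omega) j (h.e_mem i)) (ih (k - l) (by omega) _ hx)
            (by omega) (by simp)
      rw [coeff_succ]
      exact Submodule.smul_mem _ _ (sub_mem (hB hx) (Submodule.smul_mem _ _ (hB (h.proj_mem hx))))

/-- The radial vector field is the Euler vector field. -/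
theorem sum_coeff_mul {p : I → ZMod 2} (hp : d.IsGradedBy (parity (𝕜 := 𝕜) (V := g)) p)
    (hD : ∀ i j, D i * D j = superSign 𝕜 (p i) (p j) • (D j * D i)) (k : ℕ) (j : Option I) :
    ∑ i, d.coeff D k j (d.e i) * D i = if k = 0 then j.elim 0 D else 0 := by
  induction k using Nat.strong_induction_on generalizing j with
  | _ k ih =>
    cases k with
    | zero =>
      cases j with
      | none => simp [coeff_zero_none, d.lam_e]
      | some j => simp [coeff_zero_some, d.c_e, Finset.sum_ite_eq]
    | succ k =>
      have h2 : (k + 2 : 𝕜) ≠ 0 := by exact_mod_cast (k + 1).succ_ne_zero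
      have h (i : I) : (k + 2 : 𝕜) • d.coeff D (k + 1) j (d.e i)
          = d.rhs D (d.coeff D) k j (d.e i) := by
        rw [← coeff_rec, proj_e]
        module
      -- A super skew-symmetric bracket is paired with supercommuting symbols, so exchanging the
      -- indices changes the sign of the sum.
      have hanti : ∑ i, ∑ i', d.coeff D k j (br (𝕜 := 𝕜) (d.e i) (d.e i')) * D i' * D i = 0 := by
        have hS : ∑ i, ∑ i', d.coeff D k j (br (𝕜 := 𝕜) (d.e i) (d.e i')) * D i' * D i
            = - ∑ i, ∑ i', d.coeff D k j (br (𝕜 := 𝕜) (d.e i) (d.e i')) * D i' * D i := by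
          conv_lhs => rw [Finset.sum_comm]
          simp only [← Finset.sum_neg_distrib]
          refine Finset.sum_congr rfl fun i _ => Finset.sum_congr rfl fun i' _ => ?_
          rw [br_skew (hp.e_mem i') (hp.e_mem i), map_neg, map_smul, neg_mul, neg_mul,
            smul_mul_assoc, smul_mul_assoc, mul_assoc, hD i i', superSign_comm 𝕜 (p i) (p i'), mul_smul_comm,
            smul_smul, superSign_mul_self, one_smul, mul_assoc]
        have h3 := add_eq_zero_iff_eq_neg.2 hS
        rw [← two_smul 𝕜] at h3
        exact (smul_eq_zero.1 h3).resolve_left two_ne_zero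
      have h4 : (k + 2 : 𝕜) • ∑ i, d.coeff D (k + 1) j (d.e i) * D i = 0 := by
        rw [Finset.smul_sum]
        simp only [← smul_mul_assoc, h, rhs_apply, Finset.sum_mul, sub_mul,
          Finset.sum_sub_distrib, hanti, zero_sub, neg_eq_zero]
        rw [Finset.sum_comm]
        refine Finset.sum_eq_zero fun i _ => ?_
        rw [Finset.sum_comm]
        refine Finset.sum_eq_zero fun l hl => ?_
        have hl' := Finset.mem_range.1 hl
        -- The inner sum is the same radial sum in degree `k - l`, which is positive and at most
        -- `k`, so the induction hypothesis makes it vanish.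
        simp only [mul_assoc, ← Finset.mul_sum]
        rw [ih (k - l) (by omega), if_neg (by omega), mul_zero]
      rw [if_neg k.succ_ne_zero]
      exact (smul_eq_zero.1 h4).resolve_left h2

end InducingDatum

/-! ## Formal series of operators which lower the degree -/

namespace SuperSymmetric

variable {𝕜 V : Type*} [Field 𝕜] [AddCommGroup V] [Module 𝕜 V] [SuperModule 𝕜 V]

/-- An operator on `S(V)` lowers the degree by `k`. -/
def IsLowering (k : ℕ) (T : Module.End 𝕜 (SuperSymmetric 𝕜 V)) : Prop :=
  (∀ n, ∀ a ∈ homog 𝕜 V (n + k), T a ∈ homog 𝕜 V n) ∧ ∀ n < k, ∀ a ∈ homog 𝕜 V n, T a = 0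

theorem IsLowering.add {k : ℕ} {S T : Module.End 𝕜 (SuperSymmetric 𝕜 V)} (hS : IsLowering k S)
    (hT : IsLowering k T) : IsLowering k (S + T) :=
  ⟨fun n a ha => add_mem (hS.1 n a ha) (hT.1 n a ha), fun n hn a ha => by
    simp [hS.2 n hn a ha, hT.2 n hn a ha]⟩

theorem IsLowering.smul {k : ℕ} {T : Module.End 𝕜 (SuperSymmetric 𝕜 V)} (hT : IsLowering k T)
    (c : 𝕜) : IsLowering k (c • T) :=
  ⟨fun n a ha => Submodule.smul_mem _ c (hT.1 n a ha), fun n hn a ha => by simp [hT.2 n hn a ha]⟩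

theorem exists_mem_filt (a : SuperSymmetric 𝕜 V) : ∃ n, a ∈ filt 𝕜 V n := by
  have ha : a ∈ ⨆ n, homog 𝕜 V n := by rw [iSup_homog]; trivial
  induction ha using Submodule.iSup_induction' with
  | mem n a ha => exact ⟨n, homog_le_filt le_rfl ha⟩
  | zero => exact ⟨0, zero_mem _⟩
  | add a a' _ _ h h' =>
    obtain ⟨n, hn⟩ := h
    obtain ⟨n', hn'⟩ := h'
    exact ⟨max n n', add_mem (filt_mono (le_max_left _ _) hn) (filt_mono (le_max_right _ _) hn')⟩

end SuperSymmetric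

namespace SuperBasis

open SuperSymmetric

variable {I 𝕜 V : Type*} [Field 𝕜] [AddCommGroup V] [Module 𝕜 V]
  [SuperModule 𝕜 V] [Fintype I] (b : SuperBasis I 𝕜 V) [DecidableEq I]

theorem isLowering_of_mem_words {Γ : Type*} [AddCommGroup Γ] {deg : I → Γ} {k : ℕ} {γ : Γ}
    {T : Module.End 𝕜 (SuperSymmetric 𝕜 V)} (hT : T ∈ words 𝕜 b.partialDeriv deg k γ) :
    IsLowering k T := by
  induction hT using Submodule.span_induction with
  | mem T hT =>
    obtain ⟨l, rfl, -, rfl⟩ := hT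
    induction l with
    | nil => exact ⟨fun n a ha => ha, fun n hn => absurd hn (by simp)⟩
    | cons i l ih =>
      simp only [List.map_cons, List.prod_cons, List.length_cons]
      refine ⟨fun n a ha => b.partialDeriv_mem_homog i (ih.1 (n + 1) a ?_), fun n hn a ha => ?_⟩
      · rwa [add_assoc, add_comm 1]
      · rw [Module.End.mul_apply]
        rcases (Nat.lt_succ_iff.1 hn).lt_or_eq with h | h
        · rw [ih.2 n h a ha, map_zero]
        · exact b.partialDeriv_homog_zero i (ih.1 0 a (by rwa [zero_add, ← h]))
  | zero => exact ⟨fun n a _ => zero_mem _, fun n _ a _ => rfl⟩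
  | add S T _ _ hS hT => exact hS.add hT
  | smul c T _ hT => exact hT.smul c

variable [CharZero 𝕜]

/-- The operator on `S(V)` which is defined by a formal series of operators, the `k`-th of which
lowers the degree by `k`. -/
def evalSeries : (ℕ → Module.End 𝕜 (SuperSymmetric 𝕜 V)) →ₗ[𝕜]
    Module.End 𝕜 (SuperSymmetric 𝕜 V) where
  toFun P := b.glue fun n => ∑ k ∈ Finset.range (n + 1), P k
  map_add' P Q := linearMap_ext fun n a ha => by
    simp [b.glue_apply _ ha, Finset.sum_add_distrib]
  map_smul' c P := linearMap_ext fun n a ha => by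
    simp [b.glue_apply _ ha, Finset.smul_sum]

variable {P P' : ℕ → Module.End 𝕜 (SuperSymmetric 𝕜 V)}

theorem evalSeries_apply_homog (P : ℕ → Module.End 𝕜 (SuperSymmetric 𝕜 V)) {n : ℕ}
    {a : SuperSymmetric 𝕜 V} (ha : a ∈ homog 𝕜 V n) :
    b.evalSeries P a = ∑ k ∈ Finset.range (n + 1), P k a := by
  simp [evalSeries, b.glue_apply _ ha]

/-- One truncation serves all degrees up to `n`, because the superfluous terms lower the degree too
far and vanish. -/
theorem evalSeries_apply_filt (hP : ∀ k, IsLowering k (P k)) {n : ℕ}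
    {a : SuperSymmetric 𝕜 V} (ha : a ∈ filt 𝕜 V n) :
    b.evalSeries P a = ∑ k ∈ Finset.range (n + 1), P k a := by
  suffices h : filt 𝕜 V n ≤
      LinearMap.ker (b.evalSeries P - ∑ k ∈ Finset.range (n + 1), P k) by
    simpa [sub_eq_zero] using h ha
  refine filt_le fun m hm a ha => ?_
  simp only [LinearMap.mem_ker, LinearMap.sub_apply, b.evalSeries_apply_homog P ha, sub_eq_zero,
    LinearMap.sum_apply]
  refine Finset.sum_subset (Finset.range_mono (by omega)) fun k _ hk => ?_
  have := Finset.mem_range.not.1 hk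
  exact (hP k).2 m (by omega) a ha

/-- This is the Cauchy product. Only the right factor must lower degrees: it moves degree `n` to
degree `n - l`, which fixes where the left series is truncated. -/
theorem evalSeries_mul (P : ℕ → Module.End 𝕜 (SuperSymmetric 𝕜 V)) (hP' : ∀ k, IsLowering k (P' k)) :
    b.evalSeries (fun k => ∑ l ∈ Finset.HasAntidiagonal.antidiagonal k, P l.1 * P' l.2)
      = b.evalSeries P * b.evalSeries P' := by
  refine linearMap_ext fun n a ha => ?_
  rw [Module.End.mul_apply, b.evalSeries_apply_homog _ ha, b.evalSeries_apply_homog _ ha, map_sum]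
  have h1 : ∀ l ∈ Finset.range (n + 1), b.evalSeries P (P' l a)
      = ∑ m ∈ Finset.range (n + 1 - l), P m (P' l a) := fun l hl => by
    have hl' := Finset.mem_range.1 hl
    rw [b.evalSeries_apply_homog P ((hP' l).1 (n - l) a (by rwa [Nat.sub_add_cancel (by omega)])),
      Nat.sub_add_comm (by omega)]
  rw [Finset.sum_congr rfl h1,
    ← Finset.sum_range_diag_flip (n + 1) (fun l m => P m (P' l a))]
  refine Finset.sum_congr rfl fun k _ => ?_
  rw [Finset.Nat.sum_antidiagonal_eq_sum_range_succ (fun l l' => P l * P' l'),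
    LinearMap.sum_apply, ← Finset.sum_range_reflect]
  refine Finset.sum_congr rfl fun l hl => ?_
  have hl' := Finset.mem_range.1 hl
  rw [Module.End.mul_apply, show k.succ - 1 - l = k - l from rfl,
    Nat.sub_sub_self (by omega)]

/-- An operator lowering the degree by `k` has commutator with the Euler operator equal to `k` times
itself. This turns the factor `k` in the coefficient recursion into an operator identity. -/
theorem evalSeries_natCast_smul (hP : ∀ k, IsLowering k (P k)) :
    b.evalSeries (fun k => (k : 𝕜) • P k)
      = b.evalSeries P * b.euler - b.euler * b.evalSeries P := by
  refine linearMap_ext fun n a ha => ?_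
  rw [LinearMap.sub_apply, Module.End.mul_apply, Module.End.mul_apply,
    b.euler_apply ha, map_smul, b.evalSeries_apply_homog _ ha, b.evalSeries_apply_homog _ ha,
    map_sum, Finset.smul_sum, ← Finset.sum_sub_distrib]
  refine Finset.sum_congr rfl fun k hk => ?_
  have hk' := Finset.mem_range.1 hk
  rw [b.euler_apply ((hP k).1 (n - k) a (by rwa [Nat.sub_add_cancel (by omega)])),
    Nat.cast_sub (by omega), LinearMap.smul_apply]
  module

/-- Here the index counts the derivative too, so the truncations on the two sides agree term by
term. In `evalSeries_mul_partialDeriv` the index omits it, leaving one extra term that only the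
lowering hypothesis removes. -/
theorem evalSeries_shift (P : ℕ → Module.End 𝕜 (SuperSymmetric 𝕜 V)) (i : I) :
    b.evalSeries (fun k => if k = 0 then 0 else P (k - 1) * b.partialDeriv i)
      = b.evalSeries P * b.partialDeriv i := by
  refine linearMap_ext fun n a ha => ?_
  rw [Module.End.mul_apply, b.evalSeries_apply_homog _ ha]
  cases n with
  | zero => simp [b.partialDeriv_homog_zero i ha]
  | succ n =>
    rw [b.evalSeries_apply_homog _ (b.partialDeriv_mem_homog i ha), Finset.sum_range_succ']
    simp

theorem evalSeries_single (T : Module.End 𝕜 (SuperSymmetric 𝕜 V)) :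
    b.evalSeries (fun k => if k = 0 then T else 0) = T := by
  refine linearMap_ext fun n a ha => ?_
  rw [b.evalSeries_apply_homog _ ha, Finset.sum_range_succ']
  simp

theorem evalSeries_mul_partialDeriv (P : ℕ → Module.End 𝕜 (SuperSymmetric 𝕜 V))
    (hP : ∀ k, IsLowering k (P k)) (i : I) :
    b.evalSeries (fun k => P k * b.partialDeriv i) = b.evalSeries P * b.partialDeriv i := by
  refine linearMap_ext fun n a ha => ?_
  rw [Module.End.mul_apply, b.evalSeries_apply_homog _ ha]
  cases n with
  | zero => simp [b.partialDeriv_homog_zero i ha]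
  | succ n =>
    rw [b.evalSeries_apply_filt hP (homog_le_filt n.le_succ (b.partialDeriv_mem_homog i ha))]
    simp

theorem partialDeriv_mul_evalSeries (P : ℕ → Module.End 𝕜 (SuperSymmetric 𝕜 V)) (i : I) :
    b.evalSeries (fun k => b.partialDeriv i * P k) = b.partialDeriv i * b.evalSeries P := by
  refine linearMap_ext fun n a ha => ?_
  rw [Module.End.mul_apply, b.evalSeries_apply_homog _ ha, b.evalSeries_apply_homog _ ha, map_sum]
  simp

theorem evalSeries_mem_endPar (hP : ∀ k, IsLowering k (P k)) {q : ZMod 2}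
    (hq : ∀ k, P k ∈ endPar 𝕜 V q) : b.evalSeries P ∈ endPar 𝕜 V q := by
  intro j a ha
  obtain ⟨n, hn⟩ := exists_mem_filt a
  rw [b.evalSeries_apply_filt hP hn]
  exact Submodule.sum_mem _ fun k _ => hq k j a ha

theorem mem_endPar_of_mem_words {k : ℕ} {q : ZMod 2} {T : Module.End 𝕜 (SuperSymmetric 𝕜 V)}
    (hT : T ∈ words 𝕜 b.partialDeriv b.deg k q) : T ∈ endPar 𝕜 V q := by
  refine (Submodule.span_le (p := endPar 𝕜 V q)).2 ?_ hT
  rintro _ ⟨l, -, rfl, rfl⟩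
  clear hT
  induction l with
  | nil => exact one_mem_endPar
  | cons i l ih =>
    simp only [List.map_cons, List.prod_cons, List.sum_cons]
    exact mul_mem_endPar (b.partialDeriv_mem_endPar i) ih

end SuperBasis

/-! ## The fundamental vector fields -/

namespace InducingDatum

open SuperSymmetric

variable {I 𝕜 g V : Type*} [DecidableEq I] [Fintype I] [Field 𝕜] [CharZero 𝕜] [AddCommGroup g]
    [Module 𝕜 g] [LieSuperalgebra 𝕜 g] [AddCommGroup V] [Module 𝕜 V] [SuperModule 𝕜 V]
    (d : InducingDatum I 𝕜 g) (b : SuperBasis I 𝕜 V)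

/-- The coefficients of the vector field which corresponds to `x ∈ g`, as operators on `S(V)`. -/
def coeffOp (j : Option I) : g →ₗ[𝕜] Module.End 𝕜 (SuperSymmetric 𝕜 V) :=
  b.evalSeries ∘ₗ LinearMap.pi fun k => d.coeff b.partialDeriv k j

theorem coeffOp_apply (j : Option I) (x : g) :
    d.coeffOp b j x = b.evalSeries fun k => d.coeff b.partialDeriv k j x := rfl

/-- The operator on `S(V)` which corresponds to `x ∈ g`. -/
def field : g →ₗ[𝕜] Module.End 𝕜 (SuperSymmetric 𝕜 V) :=
  ∑ i, LinearMap.mulLeft 𝕜 (b.mulBasis i) ∘ₗ d.coeffOp b (some i) + d.coeffOp b none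

theorem field_apply (x : g) :
    d.field b x = ∑ i, b.mulBasis i * d.coeffOp b (some i) x + d.coeffOp b none x := by
  simp [field]

/-- The multiplication with the projection of `x ∈ g` to the complement. -/
def mulProj : g →ₗ[𝕜] Module.End 𝕜 (SuperSymmetric 𝕜 V) :=
  ∑ i, (d.c i).smulRight (b.mulBasis i)

theorem mulProj_apply (x : g) : d.mulProj b x = ∑ i, d.c i x • b.mulBasis i := by
  simp [mulProj]

variable {d b}

theorem isLowering_coeff (hp : d.IsGradedBy (parity (𝕜 := 𝕜) (V := g)) b.deg)
    (k : ℕ) (j : Option I) (x : g) :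
    IsLowering k (d.coeff b.partialDeriv k j x) := by
  obtain ⟨y, hy, z, hz, rfl⟩ := SuperModule.eq_sup (𝕜 := 𝕜) x
  rw [map_add]
  exact (b.isLowering_of_mem_words (hp.coeff_mem b.partialDeriv k j hy)).add
    (b.isLowering_of_mem_words (hp.coeff_mem b.partialDeriv k j hz))

theorem coeffOp_mem_endPar (hp : d.IsGradedBy (parity (𝕜 := 𝕜) (V := g)) b.deg)
    (j : Option I) {q : ZMod 2} {x : g} (hx : x ∈ parity (𝕜 := 𝕜) q) :
    d.coeffOp b j x ∈ endPar 𝕜 V (j.elim 0 b.deg - q) :=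
  b.evalSeries_mem_endPar (fun k => isLowering_coeff hp k j x) fun k =>
    b.mem_endPar_of_mem_words (hp.coeff_mem b.partialDeriv k j hx)

theorem field_mem_endPar (hp : d.IsGradedBy (parity (𝕜 := 𝕜) (V := g)) b.deg) {q : ZMod 2} {x : g} (hx : x ∈ parity (𝕜 := 𝕜) q) :
    d.field b x ∈ endPar 𝕜 V q := by
  have h2 : ∀ p q : ZMod 2, p + (p - q) = q := by decide
  have h3 : ∀ q : ZMod 2, 0 - q = q := by decide
  rw [field_apply]
  refine add_mem (Submodule.sum_mem _ fun i _ => ?_) ?_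
  · have := mul_mem_endPar (b.mulBasis_mem_endPar i) (coeffOp_mem_endPar hp (some i) hx)
    rwa [Option.elim_some, h2] at this
  · have := coeffOp_mem_endPar hp none hx
    rwa [Option.elim_none, h3] at this

/-- The coefficients are series in the partial derivatives, which supercommute with one another. -/
theorem partialDeriv_mul_coeffOp (hp : d.IsGradedBy (parity (𝕜 := 𝕜) (V := g)) b.deg)
    (i : I) (j : Option I) {q : ZMod 2} {x : g}
    (hx : x ∈ parity (𝕜 := 𝕜) q) :
    b.partialDeriv i * d.coeffOp b j x = (superSign 𝕜 (b.deg i) (j.elim 0 b.deg)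
      * superSign 𝕜 (b.deg i) q) • (d.coeffOp b j x * b.partialDeriv i) := by
  have h (k : ℕ) := mul_of_mem_words b.partialDeriv_mul_partialDeriv i (hp.coeff_mem b.partialDeriv k j hx)
  have h2 : ∀ p q : ZMod 2, p - q = p + q := by decide
  rw [coeffOp_apply, ← b.partialDeriv_mul_evalSeries,
    ← b.evalSeries_mul_partialDeriv _ fun k => isLowering_coeff hp k j x, ← map_smul]
  congr 1
  ext1 k
  rw [h, h2, superSign_add_right, Pi.smul_apply]

/-- The supercommutator with `∂ᵢ` extracts the `i`-th coefficient, since `∂ᵢ` only fails to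
supercommute with `bᵢ`. -/
theorem partialDeriv_mul_field (hp : d.IsGradedBy (parity (𝕜 := 𝕜) (V := g)) b.deg)
    (i : I) {q : ZMod 2} {x : g} (hx : x ∈ parity (𝕜 := 𝕜) q) :
    b.partialDeriv i * d.field b x = superSign 𝕜 (b.deg i) q • (d.field b x * b.partialDeriv i)
      + d.coeffOp b (some i) x := by
  have h (j : I) : b.partialDeriv i * (b.mulBasis j * d.coeffOp b (some j) x)
      = (if i = j then d.coeffOp b (some j) x else 0) + superSign 𝕜 (b.deg i) q •
        (b.mulBasis j * d.coeffOp b (some j) x * b.partialDeriv i) := by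
    rw [← mul_assoc, b.partialDeriv_mul_mulBasis, add_mul, smul_mul_assoc, mul_assoc,
      partialDeriv_mul_coeffOp hp i _ hx, mul_smul_comm, smul_smul, Option.elim_some, ← mul_assoc,
      superSign_mul_self, one_mul, mul_assoc]
    split_ifs <;> simp
  rw [field_apply, mul_add, Finset.mul_sum, Finset.sum_congr rfl fun j _ => h j,
    partialDeriv_mul_coeffOp hp i none hx, Finset.sum_add_distrib, Finset.sum_ite_eq, add_mul,
    Finset.sum_mul, smul_add, Finset.smul_sum]
  simp only [Finset.mem_univ, if_true, Option.elim_none, superSign_zero_right, one_mul]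
  abel

/-- By `sum_coeff_mul` only the constant terms of the coefficients survive contraction with the
derivatives. It is the infinitesimal form of the fact that one-parameter subgroups are straight
lines in exponential coordinates. -/
theorem sum_field_mul_partialDeriv (hp : d.IsGradedBy (parity (𝕜 := 𝕜) (V := g)) b.deg) :
    ∑ i, d.field b (d.e i) * b.partialDeriv i = b.euler := by
  have h (j : Option I) : ∑ i, d.coeffOp b j (d.e i) * b.partialDeriv i
      = j.elim 0 b.partialDeriv := by
    have h1 (i : I) := b.evalSeries_mul_partialDeriv _ fun k => isLowering_coeff hp k j (d.e i)
    simp only [coeffOp_apply, ← h1]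
    rw [← map_sum, ← b.evalSeries_single (j.elim 0 b.partialDeriv)]
    congr 1
    ext1 k
    rw [Finset.sum_apply, d.sum_coeff_mul _ hp b.partialDeriv_mul_partialDeriv]
  simp only [field_apply, add_mul, Finset.sum_mul, Finset.sum_add_distrib, h, mul_assoc]
  rw [Finset.sum_comm]
  simp only [← Finset.mul_sum, h]
  simp [SuperBasis.euler]

/-- This is `coeff_eq` summed over all degrees: the factor `k` becomes a commutator with `E`, and
the convolution becomes a product of operators. -/
theorem coeffOp_mul_euler (hp : d.IsGradedBy (parity (𝕜 := 𝕜) (V := g)) b.deg)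
    (j : Option I) (x : g) :
    d.coeffOp b j x * b.euler = b.euler * d.coeffOp b j x + (if j = none then 0 else d.coeffOp b j x)
      + ∑ i, (d.coeffOp b j (br (𝕜 := 𝕜) x (d.e i)) * b.partialDeriv i
        - d.coeffOp b j (d.e i) * d.coeffOp b (some i) x) := by
  have h1 := b.evalSeries_natCast_smul fun k => isLowering_coeff hp k j x
  have h2 : (fun k : ℕ => (k : 𝕜) • d.coeff b.partialDeriv k j x)
      = (if j = none then 0 else fun k => d.coeff b.partialDeriv k j x)
        + ∑ i, ((fun k => if k = 0 then 0 else
          d.coeff b.partialDeriv (k - 1) j (br (𝕜 := 𝕜) x (d.e i)) * b.partialDeriv i)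
        - fun k => ∑ l ∈ Finset.HasAntidiagonal.antidiagonal k,
          d.coeff b.partialDeriv l.1 j (d.e i) * d.coeff b.partialDeriv l.2 (some i) x) := by
    ext1 k
    have := d.coeff_eq b.partialDeriv k j x
    rw [sub_eq_iff_eq_add'] at this
    rw [this]
    simp only [Pi.add_apply, Finset.sum_apply, Pi.sub_apply]
    split_ifs <;> rfl
  rw [h2, map_add, map_sum] at h1
  have h3 (i : I) := b.evalSeries_shift
    (fun k => d.coeff b.partialDeriv k j (br (𝕜 := 𝕜) x (d.e i))) i
  have h4 (i : I) := b.evalSeries_mul (fun k => d.coeff b.partialDeriv k j (d.e i))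
    (fun k => isLowering_coeff hp k (some i) x)
  simp only [map_sub, h3, h4, ← coeffOp_apply] at h1
  rw [eq_sub_iff_add_eq'] at h1
  rw [← h1, add_assoc]
  split_ifs <;> simp [coeffOp_apply]

/-- This is the identity that symmetrization demands, and the bracket relation of `x` with every
`eᵢ` after contraction with `∂ᵢ`. -/
theorem field_mul_euler (hp : d.IsGradedBy (parity (𝕜 := 𝕜) (V := g)) b.deg) {q : ZMod 2} {x : g} (hx : x ∈ parity (𝕜 := 𝕜) q) :
    d.field b x * b.euler = ∑ i, (d.field b (br (𝕜 := 𝕜) x (d.e i)) * b.partialDeriv i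
      + superSign 𝕜 q (b.deg i) • (d.field b (d.e i) * d.field b x * b.partialDeriv i)) := by
  have h1 : d.field b x * b.euler = b.euler * d.field b x
      + ∑ i, (d.field b (br (𝕜 := 𝕜) x (d.e i)) * b.partialDeriv i
        - d.field b (d.e i) * d.coeffOp b (some i) x) := by
    -- The degree shift by `bⱼ` cancels the extra coefficient that occurs for `some j` but not for
    -- `none`, so both kinds of term obey the same formula.
    have hm (j : I) : b.mulBasis j * b.euler = b.euler * b.mulBasis j - b.mulBasis j := by
      rw [b.euler_mul_mulBasis]
      noncomm_ring
    have hj (j : I) : b.mulBasis j * d.coeffOp b (some j) x * b.euler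
        = b.euler * (b.mulBasis j * d.coeffOp b (some j) x)
          + ∑ i, (b.mulBasis j * d.coeffOp b (some j) (br (𝕜 := 𝕜) x (d.e i)) * b.partialDeriv i
            - b.mulBasis j * d.coeffOp b (some j) (d.e i) * d.coeffOp b (some i) x) := by
      rw [mul_assoc, coeffOp_mul_euler hp, if_neg (by simp), mul_add, mul_add, ← mul_assoc, hm,
        Finset.mul_sum]
      simp only [mul_sub, sub_mul, mul_assoc]
      abel
    rw [field_apply, add_mul, Finset.sum_mul, Finset.sum_congr rfl fun j _ => hj j,
      coeffOp_mul_euler hp, if_pos rfl]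
    simp only [field_apply, add_mul, Finset.sum_mul, mul_add, Finset.mul_sum,
      Finset.sum_add_distrib, Finset.sum_sub_distrib, add_zero]
    rw [Finset.sum_comm (f := fun i j => b.mulBasis i * d.coeffOp b (some i) _ * b.partialDeriv j),
      Finset.sum_comm (f := fun i j => b.mulBasis i * d.coeffOp b (some i) _ *
        d.coeffOp b (some j) x)]
    abel
  -- Once the left factor `E` is expanded, moving each `∂ᵢ` to the right past `d.field b x` releases
  -- exactly the coefficient being subtracted.
  rw [h1, ← sum_field_mul_partialDeriv hp, Finset.sum_mul, ← Finset.sum_add_distrib]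
  refine Finset.sum_congr rfl fun i _ => ?_
  rw [mul_assoc, partialDeriv_mul_field hp i hx, mul_add, mul_smul_comm, superSign_comm, mul_assoc]
  abel

/-- Only the constant terms of the vector coefficients raise the degree, and together they form
`mulProj`; every remaining term preserves or lowers it. -/
theorem field_apply_sub_mem_filt (hp : d.IsGradedBy (parity (𝕜 := 𝕜) (V := g)) b.deg)
    (x : g) {n : ℕ} {a : SuperSymmetric 𝕜 V}
    (ha : a ∈ filt 𝕜 V n) : d.field b x a - d.mulProj b x a ∈ filt 𝕜 V n := by
  refine filt_le (W := (filt 𝕜 V n).comap (d.field b x - d.mulProj b x)) (fun m hm a ha => ?_) ha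
  have h (j : Option I) (k : ℕ) (hk : k ≤ m) :
      d.coeff b.partialDeriv k j x a ∈ homog 𝕜 V (m - k) :=
    (isLowering_coeff hp k j x).1 (m - k) a (by rwa [Nat.sub_add_cancel hk])
  rw [Submodule.mem_comap, field_apply, mulProj_apply, add_sub_right_comm,
    ← Finset.sum_sub_distrib, LinearMap.add_apply, LinearMap.sum_apply]
  refine add_mem (Submodule.sum_mem _ fun i _ => ?_) ?_
  · rw [LinearMap.sub_apply, Module.End.mul_apply, coeffOp_apply, b.evalSeries_apply_homog _ ha,
      map_sum, Finset.sum_range_succ', coeff_zero_some]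
    simp only [Module.algebraMap_end_apply, map_smul, LinearMap.smul_apply, add_sub_cancel_right]
    refine Submodule.sum_mem _ fun k hk => ?_
    have hk' := Finset.mem_range.1 hk
    refine homog_le_filt (k := m - (k + 1) + 1) (by omega) (b.mulBasis_mem_homog i (h _ _ hk'))
  · rw [coeffOp_apply, b.evalSeries_apply_homog _ ha]
    refine Submodule.sum_mem _ fun k hk => ?_
    have hk' := Finset.mem_range.1 hk
    exact homog_le_filt (by omega) (h _ _ (by omega))

theorem field_one (x : g) : d.field b x 1 = d.mulProj b x 1 + d.lam x • 1 := by
  simp [field_apply, mulProj_apply, coeffOp_apply, b.evalSeries_apply_homog _ one_mem_homog,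
    coeff_zero_some, coeff_zero_none]

end InducingDatum

/-! ## The commutation relations of the fundamental vector fields -/

/-- The super Jacobi identity for operators which satisfy the bracket relations up to error
terms. -/
theorem superJacobi_defect {𝕜 A : Type*} [Field 𝕜] [Ring A] [Algebra 𝕜 A] {α β γ : 𝕜}
    (hα : α = 1 ∨ α = -1) (hβ : β = 1 ∨ β = -1) (hγ : γ = 1 ∨ γ = -1)
    (X Y Z Lxz Lzy Lxy Lxzy Lzxy M : A) (hM : M = Lxzy + α • Lzxy) :
    (X * Z - α • (Z * X) - Lxz) * Y
      = (β * γ) • (Y * (X * Z - α • (Z * X) - Lxz))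
        + X * (Z * Y - γ • (Y * Z) - Lzy)
        - α • (β • ((Z * Y - γ • (Y * Z) - Lzy) * X))
        - α • (Z * (X * Y - β • (Y * X) - Lxy))
        + γ • ((X * Y - β • (Y * X) - Lxy) * Z)
        + (X * Lzy - (α * β) • (Lzy * X) - M)
        - α • (Z * Lxy - (α * γ) • (Lxy * Z) - Lzxy)
        - (Lxz * Y - (β * γ) • (Y * Lxz) - Lxzy) := by
  subst hM
  rcases hα with rfl | rfl <;> rcases hβ with rfl | rfl <;> rcases hγ with rfl | rfl <;>
    simp only [one_smul, neg_smul, mul_one, mul_neg, neg_neg] <;>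
    noncomm_ring

namespace InducingDatum

open SuperSymmetric

variable {I 𝕜 g V : Type*} [DecidableEq I] [Fintype I] [Field 𝕜] [CharZero 𝕜] [AddCommGroup g]
    [Module 𝕜 g] [LieSuperalgebra 𝕜 g] [AddCommGroup V] [Module 𝕜 V] [SuperModule 𝕜 V]
    (d : InducingDatum I 𝕜 g) (b : SuperBasis I 𝕜 V)

/-- The failure of the vector fields to satisfy the bracket relation for `x` and `z` of parities
`q` and `r`. -/
def defect (q r : ZMod 2) (x z : g) : Module.End 𝕜 (SuperSymmetric 𝕜 V) :=
  d.field b x * d.field b z - superSign 𝕜 q r • (d.field b z * d.field b x)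
    - d.field b (br (𝕜 := 𝕜) x z)

variable {d b}

theorem defect_add_left (q r : ZMod 2) (x x' z : g) :
    d.defect b q r (x + x') z = d.defect b q r x z + d.defect b q r x' z := by
  simp only [defect, map_add, add_mul, mul_add, LinearMap.add_apply, smul_add]
  abel

theorem defect_add_right (q r : ZMod 2) (x z z' : g) :
    d.defect b q r x (z + z') = d.defect b q r x z + d.defect b q r x z' := by
  simp only [defect, map_add, add_mul, mul_add, smul_add]
  abel

theorem defect_sum_right {J : Type*} (s : Finset J) (c : J → 𝕜) (q r : ZMod 2) (x : g) (z : J → g) :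
    d.defect b q r x (∑ i ∈ s, c i • z i) = ∑ i ∈ s, c i • d.defect b q r x (z i) := by
  simp only [defect, map_sum, map_smul, Finset.mul_sum, Finset.sum_mul, smul_sub, Finset.smul_sum,
    Finset.sum_sub_distrib, mul_smul_comm, smul_mul_assoc, smul_comm (superSign 𝕜 q r)]

/-- The supercommutator and the bracket have the same skew-symmetry, so their difference does too.
-/
theorem defect_swap {q r : ZMod 2} {x z : g} (hx : x ∈ parity (𝕜 := 𝕜) q)
    (hz : z ∈ parity (𝕜 := 𝕜) r) :
    superSign 𝕜 q r • d.defect b r q z x = - d.defect b q r x z := by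
  rw [defect, defect, br_skew hx hz, superSign_comm 𝕜 r q, map_neg, map_smul, smul_sub, smul_sub,
    smul_smul, superSign_mul_self, one_smul]
  abel

theorem sum_defect_mul_partialDeriv (hp : d.IsGradedBy (parity (𝕜 := 𝕜) (V := g)) b.deg)
    {q : ZMod 2} {x : g} (hx : x ∈ parity (𝕜 := 𝕜) q) :
    ∑ i, d.defect b q (b.deg i) x (d.e i) * b.partialDeriv i = 0 := by
  have h := field_mul_euler hp hx
  rw [← sum_field_mul_partialDeriv hp, Finset.mul_sum, ← sub_eq_zero,
    ← Finset.sum_sub_distrib] at h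
  rw [← h]
  refine Finset.sum_congr rfl fun i _ => ?_
  rw [defect, sub_mul, sub_mul, smul_mul_assoc, mul_assoc (d.field b x)]
  abel

theorem sum_defect_partialDeriv (hp : d.IsGradedBy (parity (𝕜 := 𝕜) (V := g)) b.deg)
    {q : ZMod 2} {x : g} (hx : x ∈ parity (𝕜 := 𝕜) q) (a : SuperSymmetric 𝕜 V) :
    ∑ i, d.defect b q (b.deg i) x (d.e i) (b.partialDeriv i a) = 0 := by
  simpa using LinearMap.congr_fun (sum_defect_mul_partialDeriv hp hx) a

theorem partialDeriv_mulProj (hp : d.IsGradedBy (parity (𝕜 := 𝕜) (V := g)) b.deg)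
    (i : I) {q : ZMod 2} {x : g} (hx : x ∈ parity (𝕜 := 𝕜) q) (a : SuperSymmetric 𝕜 V) :
    b.partialDeriv i (d.mulProj b x a) = d.c i x • a
      + superSign 𝕜 q (b.deg i) • d.mulProj b x (b.partialDeriv i a) := by
  have h (j : I) : d.c j x • b.partialDeriv i (b.mulBasis j a)
      = (if i = j then d.c i x • a else 0)
        + superSign 𝕜 q (b.deg i) • d.c j x • b.mulBasis j (b.partialDeriv i a) := by
    rw [b.partialDeriv_mulBasis, smul_add]
    congr 1
    · split_ifs with hij <;> simp [hij]
    · by_cases hj : q = b.deg j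
      · rw [hj, superSign_comm, smul_comm]
      · simp [hp.c_eq_zero q j hj x hx]
  simp only [mulProj_apply, LinearMap.sum_apply, map_sum, LinearMap.smul_apply, map_smul, h,
    Finset.sum_add_distrib, Finset.smul_sum, Finset.sum_ite_eq, Finset.mem_univ, if_true]

/-- If the bracket relations hold in small degree then only the leading term of a vector field
contributes to this sum. -/
theorem sum_defect_field_partialDeriv (hp : d.IsGradedBy (parity (𝕜 := 𝕜) (V := g)) b.deg)
    {q r : ZMod 2} {x z : g} (hx : x ∈ parity (𝕜 := 𝕜) q) (hz : z ∈ parity (𝕜 := 𝕜) r) {n : ℕ}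
    (ih : ∀ k < n, ∀ i, ∀ a ∈ homog 𝕜 V k, d.defect b r (b.deg i) z (d.e i) a = 0)
    {a : SuperSymmetric 𝕜 V} (ha : a ∈ homog 𝕜 V n) :
    ∑ i, superSign 𝕜 q (b.deg i) •
        d.defect b r (b.deg i) z (d.e i) (d.field b x (b.partialDeriv i a))
      = - d.defect b r q z (d.proj x) a := by
  -- The remainder after the leading term stays in degrees below `n`, where the defect is already
  -- known to vanish.
  have h1 (i : I) : d.defect b r (b.deg i) z (d.e i) (d.field b x (b.partialDeriv i a))
      = d.defect b r (b.deg i) z (d.e i) (d.mulProj b x (b.partialDeriv i a)) := by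
    rw [← sub_eq_zero, ← map_sub]
    cases n with
    | zero => simp [b.partialDeriv_homog_zero i ha]
    | succ n =>
      have h := field_apply_sub_mem_filt hp x (homog_le_filt le_rfl (b.partialDeriv_mem_homog i ha))
      exact filt_le (W := LinearMap.ker (d.defect b r (b.deg i) z (d.e i)))
        (fun k hk a ha => ih k (by omega) i a ha) h
  -- With `∂ᵢ` moved outside, its contribution sums to zero by `sum_defect_partialDeriv`; the
  -- coordinates left over assemble into `proj x`.
  have h2 (i : I) : superSign 𝕜 q (b.deg i) • d.mulProj b x (b.partialDeriv i a)
      = b.partialDeriv i (d.mulProj b x a) - d.c i x • a := by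
    rw [partialDeriv_mulProj hp i hx]
    abel
  have h3 (i : I) : d.c i x • d.defect b r (b.deg i) z (d.e i)
      = d.c i x • d.defect b r q z (d.e i) := by
    by_cases hi : q = b.deg i
    · rw [hi]
    · simp [hp.c_eq_zero q i hi x hx]
  simp only [h1, ← map_smul, h2, map_sub, Finset.sum_sub_distrib, sum_defect_partialDeriv hp hz]
  rw [zero_sub, neg_inj, d.proj_apply, defect_sum_right, LinearMap.sum_apply]
  refine Finset.sum_congr rfl fun i _ => ?_
  rw [← h3, map_smul, LinearMap.smul_apply]

/-- The factor `n` is written as `E = ∑ eᵢ ∂ᵢ`, and the super Jacobi identity moves the defect past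
`eᵢ`. Defects applied directly to `∂ᵢ a` vanish by induction or after summation; the two terms with
a field in between reduce to their leading parts. -/
theorem defect_apply_smul (hp : d.IsGradedBy (parity (𝕜 := 𝕜) (V := g)) b.deg)
    {n : ℕ} (ih : ∀ k < n, ∀ q r, ∀ x ∈ parity (𝕜 := 𝕜) (V := g) q,
      ∀ z ∈ parity (𝕜 := 𝕜) (V := g) r, ∀ a ∈ homog 𝕜 V k, d.defect b q r x z a = 0)
    {q r : ZMod 2} {x z : g} (hx : x ∈ parity (𝕜 := 𝕜) q) (hz : z ∈ parity (𝕜 := 𝕜) r)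
    {a : SuperSymmetric 𝕜 V} (ha : a ∈ homog 𝕜 V n) :
    (n : 𝕜) • d.defect b q r x z a
      = - d.defect b q r (d.proj x) z a - d.defect b q r x (d.proj z) a := by
  have ih' {q r : ZMod 2} {x z : g} (hx : x ∈ parity (𝕜 := 𝕜) q) (hz : z ∈ parity (𝕜 := 𝕜) r)
      (i : I) : d.defect b q r x z (b.partialDeriv i a) = 0 := by
    cases n with
    | zero => simp [b.partialDeriv_homog_zero i ha]
    | succ n => exact ih n n.lt_succ_self q r x hx z hz _ (b.partialDeriv_mem_homog i ha)
  have key (i : I) := LinearMap.congr_fun (superJacobi_defect (superSign_eq_or 𝕜 q r)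
    (superSign_eq_or 𝕜 q (b.deg i)) (superSign_eq_or 𝕜 r (b.deg i)) (d.field b x)
    (d.field b (d.e i)) (d.field b z) (d.field b (br (𝕜 := 𝕜) x z))
    (d.field b (br (𝕜 := 𝕜) z (d.e i))) (d.field b (br (𝕜 := 𝕜) x (d.e i)))
    (d.field b (br (𝕜 := 𝕜) (br (𝕜 := 𝕜) x z) (d.e i)))
    (d.field b (br (𝕜 := 𝕜) z (br (𝕜 := 𝕜) x (d.e i))))
    (d.field b (br (𝕜 := 𝕜) x (br (𝕜 := 𝕜) z (d.e i))))
    (by rw [br_jacobi _ hx hz, map_add, map_smul])) (b.partialDeriv i a)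
  have hzx (i : I) : d.field b z * d.field b (br (𝕜 := 𝕜) x (d.e i))
      - (superSign 𝕜 q r * superSign 𝕜 r (b.deg i)) •
        (d.field b (br (𝕜 := 𝕜) x (d.e i)) * d.field b z)
      - d.field b (br (𝕜 := 𝕜) z (br (𝕜 := 𝕜) x (d.e i)))
      = d.defect b r (q + b.deg i) z (br (𝕜 := 𝕜) x (d.e i)) := by
    rw [defect, superSign_add_right, superSign_comm 𝕜 r q]
  simp only [hzx, ← superSign_add_right, ← superSign_add_left, ← defect.eq_def] at key
  have key' (i : I) : d.defect b q r x z (d.field b (d.e i) (b.partialDeriv i a))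
      = d.field b x (d.defect b r (b.deg i) z (d.e i) (b.partialDeriv i a))
        - superSign 𝕜 q r • superSign 𝕜 q (b.deg i) •
          d.defect b r (b.deg i) z (d.e i) (d.field b x (b.partialDeriv i a))
        - superSign 𝕜 q r • d.field b z (d.defect b q (b.deg i) x (d.e i) (b.partialDeriv i a))
        + superSign 𝕜 r (b.deg i) •
          d.defect b q (b.deg i) x (d.e i) (d.field b z (b.partialDeriv i a))
        - d.defect b (q + r) (b.deg i) (br (𝕜 := 𝕜) x z) (d.e i) (b.partialDeriv i a) := by
    have h := key i
    simp only [Module.End.mul_apply, LinearMap.add_apply, LinearMap.sub_apply,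
      LinearMap.smul_apply, ih' hx hz, ih' hx (br_mem hz (hp.e_mem i)),
      ih' hz (br_mem hx (hp.e_mem i))] at h
    simpa using h
  have hE : ∑ i, d.defect b q r x z (d.field b (d.e i) (b.partialDeriv i a))
      = (n : 𝕜) • d.defect b q r x z a := by
    rw [← map_smul, ← b.euler_apply ha, ← sum_field_mul_partialDeriv hp, ← map_sum]
    simp
  rw [← hE, Finset.sum_congr rfl fun i _ => key' i]
  simp only [Finset.sum_add_distrib, Finset.sum_sub_distrib, ← map_sum, ← Finset.smul_sum,
    sum_defect_partialDeriv hp hz, sum_defect_partialDeriv hp hx,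
    sum_defect_partialDeriv hp (br_mem hx hz), map_zero, smul_zero, sub_zero, zero_sub]
  rw [sum_defect_field_partialDeriv hp hx hz (fun k hk i => ih k hk _ _ _ hz _ (hp.e_mem i)) ha,
    sum_defect_field_partialDeriv hp hz hx (fun k hk i => ih k hk _ _ _ hx _ (hp.e_mem i)) ha]
  have := LinearMap.congr_fun (defect_swap (d := d) (b := b) (hp.proj_mem hx) hz) a
  rw [LinearMap.smul_apply, LinearMap.neg_apply] at this
  rw [smul_neg, this]
  abel

theorem defect_apply_eq_zero (hp : d.IsGradedBy (parity (𝕜 := 𝕜) (V := g)) b.deg) (n : ℕ) :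
    ∀ q r, ∀ x ∈ parity (𝕜 := 𝕜) (V := g) q, ∀ z ∈ parity (𝕜 := 𝕜) (V := g) r,
      ∀ a ∈ homog 𝕜 V n, d.defect b q r x z a = 0 := by
  induction n using Nat.strong_induction_on with
  | _ n ih =>
    intro q r x hx z hz a ha
    have h1 : (n : 𝕜) + 1 ≠ 0 := by exact_mod_cast n.succ_ne_zero
    have h2 : (n : 𝕜) + 2 ≠ 0 := by exact_mod_cast (n + 1).succ_ne_zero
    -- Since `proj` is idempotent, projected arguments return the same defect: two of them give the
    -- factor `n + 2`, one gives `n + 1`. The unprojected case then has the factor `n`, so degree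
    -- zero is treated separately.
    have hpp : d.defect b q r (d.proj x) (d.proj z) a = 0 := by
      have h := defect_apply_smul hp ih (hp.proj_mem hx) (hp.proj_mem hz) ha
      rw [proj_proj, proj_proj, ← sub_eq_zero] at h
      refine (smul_eq_zero.1 ((?_ : _ = _).trans h)).resolve_left h2
      module
    have hpz : d.defect b q r (d.proj x) z a = 0 := by
      have h := defect_apply_smul hp ih (hp.proj_mem hx) hz ha
      rw [proj_proj, hpp, ← sub_eq_zero] at h
      refine (smul_eq_zero.1 ((?_ : _ = _).trans h)).resolve_left h1
      module
    have hxp : d.defect b q r x (d.proj z) a = 0 := by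
      have h := defect_apply_smul hp ih hx (hp.proj_mem hz) ha
      rw [proj_proj, hpp, ← sub_eq_zero] at h
      refine (smul_eq_zero.1 ((?_ : _ = _).trans h)).resolve_left h1
      module
    cases n with
    | succ n =>
      have h := defect_apply_smul hp ih hx hz ha
      rw [hpz, hxp, neg_zero, sub_zero] at h
      exact (smul_eq_zero.1 h).resolve_left (by exact_mod_cast n.succ_ne_zero)
    | zero =>
      obtain ⟨c, rfl⟩ := mem_homog_zero ha
      rw [map_smul] at hpz hxp ⊢
      by_cases hc : c = 0
      · simp [hc]
      rw [smul_eq_zero_iff_right hc] at hpz hxp ⊢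
      have hker (y : g) (i : I) : d.c i (y - d.proj y) = 0 := by simp
      have hone {y : g} (hy : ∀ i, d.c i y = 0) : d.field b y 1 = d.lam y • 1 := by
        simp [field_one, mulProj_apply, hy]
      have hq : x - d.proj x ∈ parity (𝕜 := 𝕜) q := sub_mem hx (hp.proj_mem hx)
      have hr : z - d.proj z ∈ parity (𝕜 := 𝕜) r := sub_mem hz (hp.proj_mem hz)
      -- Elements of the subalgebra act on `1` by the scalar `lam`, which kills their brackets. The
      -- sign is harmless because `lam` vanishes on odd elements.
      have hkk : d.defect b q r (x - d.proj x) (z - d.proj z) 1 = 0 := by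
        have hbr := hone (d.c_br _ _ (hker x) (hker z))
        rw [d.lam_br _ _ (hker x) (hker z), zero_smul] at hbr
        have hlam : superSign 𝕜 q r * (d.lam (x - d.proj x) * d.lam (z - d.proj z))
            = d.lam (x - d.proj x) * d.lam (z - d.proj z) := by
          by_cases h : q = 0
          · simp [h]
          · simp only [hp.lam_eq_zero q h _ hq, zero_mul, mul_zero]
        simp only [defect, LinearMap.sub_apply, LinearMap.smul_apply, Module.End.mul_apply, hbr,
          hone (hker x), hone (hker z), LinearMap.map_smul, smul_smul]
        rw [mul_comm (d.lam (z - d.proj z)), mul_comm (d.lam (x - _)) (d.lam (z - _)),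
          mul_comm (d.lam (z - _)) (d.lam (x - _)), hlam, sub_self, sub_zero]
      have h3 : d.defect b q r x z = d.defect b q r (x - d.proj x) (z - d.proj z)
          + d.defect b q r (d.proj x) z + d.defect b q r x (d.proj z)
          - d.defect b q r (d.proj x) (d.proj z) := by
        conv_lhs => rw [← sub_add_cancel x (d.proj x), defect_add_left]
        conv_lhs => enter [1]; rw [← sub_add_cancel z (d.proj z), defect_add_right]
        conv_rhs => enter [1, 2]; rw [← sub_add_cancel x (d.proj x), defect_add_left]
        abel
      rw [map_smul, smul_eq_zero_iff_right hc] at hpp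
      rw [h3, LinearMap.sub_apply, LinearMap.add_apply, LinearMap.add_apply, hkk, hpz, hxp, hpp]
      simp

/-- The vector fields satisfy the bracket relations of `g`. -/
theorem field_br (hp : d.IsGradedBy (parity (𝕜 := 𝕜) (V := g)) b.deg) (q r : ZMod 2) (x z : g)
    (hx : x ∈ parity (𝕜 := 𝕜) q) (hz : z ∈ parity (𝕜 := 𝕜) r) :
    d.field b (br (𝕜 := 𝕜) x z) = d.field b x * d.field b z
      - superSign 𝕜 q r • (d.field b z * d.field b x) := by
  have h : d.defect b q r x z = 0 :=
    linearMap_ext fun n a ha => defect_apply_eq_zero hp n q r x hx z hz a ha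
  exact (sub_eq_zero.1 h).symm

end InducingDatum

/-! ## The symmetrization map -/

namespace InducingDatum

open SuperSymmetric

variable {I 𝕜 g V M : Type*} [DecidableEq I] [Fintype I] [Field 𝕜] [CharZero 𝕜] [AddCommGroup g]
    [Module 𝕜 g] [LieSuperalgebra 𝕜 g] [AddCommGroup V] [Module 𝕜 V] [SuperModule 𝕜 V]
    [AddCommGroup M] [Module 𝕜 M]
    (d : InducingDatum I 𝕜 g) (b : SuperBasis I 𝕜 V) (τ : g →ₗ[𝕜] Module.End 𝕜 M)

/-- The component of degree `n` of the symmetrization map. -/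
def symmComponent (v : M) : ℕ → SuperSymmetric 𝕜 V →ₗ[𝕜] M
  | 0 => (augmentation 𝕜 V).toLinearMap.smulRight v
  | n + 1 => (n + 1 : 𝕜)⁻¹ • ∑ i, τ (d.e i) ∘ₗ symmComponent v n ∘ₗ b.partialDeriv i

/-- The symmetrization map `S(V) → M` with `1 ↦ v`, for a module `M` over `g`. -/
def symm (v : M) : SuperSymmetric 𝕜 V →ₗ[𝕜] M := b.glue (d.symmComponent b τ v)

variable {d b τ}

theorem symm_one (v : M) : d.symm b τ v 1 = v := by
  rw [symm, b.glue_apply _ one_mem_homog, symmComponent]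
  simp

theorem symm_euler (v : M) (a : SuperSymmetric 𝕜 V) :
    d.symm b τ v (b.euler a) = ∑ i, τ (d.e i) (d.symm b τ v (b.partialDeriv i a)) := by
  suffices h : d.symm b τ v ∘ₗ b.euler = ∑ i, τ (d.e i) ∘ₗ d.symm b τ v ∘ₗ b.partialDeriv i by
    simpa using LinearMap.congr_fun h a
  refine linearMap_ext fun n a ha => ?_
  simp only [LinearMap.comp_apply, LinearMap.sum_apply, b.euler_apply ha]
  cases n with
  | zero => simp [b.partialDeriv_homog_zero _ ha]
  | succ n =>
    have h (i : I) := b.glue_apply (d.symmComponent b τ v) (b.partialDeriv_mem_homog i ha)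
    have h1 : (n + 1 : 𝕜) ≠ 0 := by exact_mod_cast n.succ_ne_zero
    simp only [symm, map_smul, b.glue_apply _ ha, h]
    rw [symmComponent]
    push_cast
    simp [smul_smul, h1]

/-- The recursion of `InducingDatum.symm_euler` determines a linear map. -/
theorem eq_of_euler {f f' : SuperSymmetric 𝕜 V →ₗ[𝕜] M}
    (hf : ∀ a, f (b.euler a) = ∑ i, τ (d.e i) (f (b.partialDeriv i a)))
    (hf' : ∀ a, f' (b.euler a) = ∑ i, τ (d.e i) (f' (b.partialDeriv i a)))
    (h1 : f 1 = f' 1) : f = f' := by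
  refine linearMap_ext fun n => ?_
  induction n with
  | zero =>
    intro a ha
    obtain ⟨c, rfl⟩ := mem_homog_zero ha
    rw [map_smul, map_smul, h1]
  | succ n ih =>
    intro a ha
    have h : ((n + 1 : ℕ) : 𝕜) • f a = ((n + 1 : ℕ) : 𝕜) • f' a := by
      rw [← map_smul, ← map_smul, ← b.euler_apply ha, hf, hf']
      exact Finset.sum_congr rfl fun i _ => by rw [ih _ (b.partialDeriv_mem_homog i ha)]
    exact smul_right_injective M (by exact_mod_cast n.succ_ne_zero) h

theorem mulProj_mem_homog (x : g) {n : ℕ} {a : SuperSymmetric 𝕜 V} (ha : a ∈ homog 𝕜 V n) :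
    d.mulProj b x a ∈ homog 𝕜 V (n + 1) := by
  rw [mulProj_apply, LinearMap.sum_apply]
  exact Submodule.sum_mem _ fun i _ => Submodule.smul_mem _ _ (b.mulBasis_mem_homog i ha)

theorem mulProj_proj (x : g) : d.mulProj b (d.proj x) = d.mulProj b x := by
  simp [mulProj_apply]

/-- Up to terms of lower degree, `x ∈ g` acts on the image of the symmetrization map as the
multiplication with its projection. -/
theorem symm_mulProj_sub_mem (hp : d.IsGradedBy (parity (𝕜 := 𝕜) (V := g)) b.deg)
    (hτ : ∀ (q r : ZMod 2) (x z : g), x ∈ parity (𝕜 := 𝕜) q → z ∈ parity (𝕜 := 𝕜) r →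
      τ (br (𝕜 := 𝕜) x z) = τ x * τ z - superSign 𝕜 q r • (τ z * τ x))
    {v : M} (hv : ∀ x, (∀ i, d.c i x = 0) → τ x v = d.lam x • v) (n : ℕ) :
    ∀ q, ∀ x ∈ parity (𝕜 := 𝕜) (V := g) q, ∀ a ∈ homog 𝕜 V n,
      τ x (d.symm b τ v a) - d.symm b τ v (d.mulProj b x a)
        ∈ (filt 𝕜 V n).map (d.symm b τ v) := by
  induction n using Nat.strong_induction_on with
  | _ n ih =>
    have step (q : ZMod 2) (x : g) (hx : x ∈ parity (𝕜 := 𝕜) q) (a : SuperSymmetric 𝕜 V)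
        (ha : a ∈ homog 𝕜 V n) :
        (n : 𝕜) • (τ x (d.symm b τ v a) - d.symm b τ v (d.mulProj b x a))
          + (τ (d.proj x) (d.symm b τ v a) - d.symm b τ v (d.mulProj b (d.proj x) a))
          ∈ (filt 𝕜 V n).map (d.symm b τ v) := by
      have h1 : (n : 𝕜) • τ x (d.symm b τ v a)
          = ∑ i, τ x (τ (d.e i) (d.symm b τ v (b.partialDeriv i a))) := by
        -- The Euler recursion is used twice: here on `a`, where `x` is then moved past `eᵢ`, and in
        -- `h2` on the product of `x` with `a`, expanded by Leibniz. The difference involves only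
        -- the `∂ᵢ a`, to which induction applies.
        rw [← map_smul, ← map_smul, ← b.euler_apply ha, symm_euler, map_sum]
      have h2 : (n + 1 : 𝕜) • d.symm b τ v (d.mulProj b x a)
          = τ (d.proj x) (d.symm b τ v a) + ∑ i, superSign 𝕜 q (b.deg i) •
            τ (d.e i) (d.symm b τ v (d.mulProj b x (b.partialDeriv i a))) := by
        have := b.euler_apply (mulProj_mem_homog (d := d) (b := b) x ha)
        push_cast at this
        rw [← map_smul, ← this, symm_euler, d.proj_apply]
        simp only [partialDeriv_mulProj hp _ hx, map_add, map_smul, map_sum,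
          Finset.sum_add_distrib, LinearMap.sum_apply, LinearMap.smul_apply]
      have h3 (i : I) : τ x (τ (d.e i) (d.symm b τ v (b.partialDeriv i a)))
          = τ (br (𝕜 := 𝕜) x (d.e i)) (d.symm b τ v (b.partialDeriv i a))
            + superSign 𝕜 q (b.deg i) • τ (d.e i) (τ x (d.symm b τ v (b.partialDeriv i a))) := by
        rw [hτ _ _ _ _ hx (hp.e_mem i)]
        simp
      have h4 : (n : 𝕜) • (τ x (d.symm b τ v a) - d.symm b τ v (d.mulProj b x a))
          + (τ (d.proj x) (d.symm b τ v a) - d.symm b τ v (d.mulProj b (d.proj x) a))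
          = ∑ i, (τ (br (𝕜 := 𝕜) x (d.e i)) (d.symm b τ v (b.partialDeriv i a))
            + superSign 𝕜 q (b.deg i) • τ (d.e i) (τ x (d.symm b τ v (b.partialDeriv i a))
              - d.symm b τ v (d.mulProj b x (b.partialDeriv i a)))) := by
        simp only [map_sub, smul_sub, Finset.sum_add_distrib, Finset.sum_sub_distrib]
        rw [← sub_eq_iff_eq_add'] at h2
        rw [← h2, ← sub_eq_zero]
        rw [h1, Finset.sum_congr rfl fun i _ => h3 i, Finset.sum_add_distrib, mulProj_proj]
        module
      rw [h4]
      cases n with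
      | zero => simp [b.partialDeriv_homog_zero _ ha]
      | succ n =>
        have hle : (filt 𝕜 V n).map (d.symm b τ v) ≤ (filt 𝕜 V (n + 1)).map (d.symm b τ v) :=
          Submodule.map_mono (filt_mono n.le_succ)
        have stable (r : ZMod 2) (y : g) (hy : y ∈ parity (𝕜 := 𝕜) r) :
            (filt 𝕜 V n).map (d.symm b τ v)
              ≤ ((filt 𝕜 V (n + 1)).map (d.symm b τ v)).comap (τ y) := by
          refine Submodule.map_le_iff_le_comap.2 (filt_le fun k hk a ha => ?_)
          rw [Submodule.mem_comap, Submodule.mem_comap,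
            ← sub_add_cancel (τ y (d.symm b τ v a)) (d.symm b τ v (d.mulProj b y a))]
          refine add_mem (Submodule.map_mono (filt_mono (by omega))
            (ih k (by omega) r y hy a ha)) (Submodule.mem_map_of_mem
              (homog_le_filt (by omega) (mulProj_mem_homog y ha)))
        refine Submodule.sum_mem _ fun i _ => add_mem ?_ (Submodule.smul_mem _ _ ?_)
        · exact stable _ _ (br_mem hx (hp.e_mem i)) (Submodule.mem_map_of_mem
            (homog_le_filt le_rfl (b.partialDeriv_mem_homog i ha)))
        · exact stable _ _ (hp.e_mem i)
            (ih n n.lt_succ_self q x hx _ (b.partialDeriv_mem_homog i ha))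
    intro q x hx a ha
    have h1 : (n : 𝕜) + 1 ≠ 0 := by exact_mod_cast n.succ_ne_zero
    -- As for the defect, `step` at the projected element has the invertible factor `n + 1`; in
    -- degree zero the subalgebra acts on `v` through `lam`.
    have hproj : τ (d.proj x) (d.symm b τ v a) - d.symm b τ v (d.mulProj b (d.proj x) a)
        ∈ (filt 𝕜 V n).map (d.symm b τ v) := by
      have h := step q _ (hp.proj_mem hx) a ha
      rw [proj_proj] at h
      refine (Submodule.smul_mem_iff _ h1).1 ?_
      rwa [add_smul, one_smul]
    cases n with
    | succ n =>
      exact (Submodule.smul_mem_iff _ (by exact_mod_cast n.succ_ne_zero)).1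
        ((Submodule.add_mem_iff_left _ hproj).1 (step q x hx a ha))
    | zero =>
      obtain ⟨c, rfl⟩ := mem_homog_zero ha
      have h2 : τ (x - d.proj x) v = d.lam (x - d.proj x) • v := hv _ fun i => by simp
      have h3 : τ x (d.symm b τ v (c • 1)) - d.symm b τ v (d.mulProj b x (c • 1))
          = d.symm b τ v ((c * d.lam x) • 1)
            + (τ (d.proj x) (d.symm b τ v (c • 1))
              - d.symm b τ v (d.mulProj b (d.proj x) (c • 1))) := by
        rw [map_sub, map_sub, lam_proj, sub_zero, LinearMap.sub_apply, sub_eq_iff_eq_add] at h2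
        simp only [map_smul, symm_one, h2, mulProj_proj]
        module
      rw [h3]
      exact add_mem (Submodule.mem_map_of_mem (homog_le_filt le_rfl
        (Submodule.smul_mem _ _ one_mem_homog))) hproj

/-- The image of the symmetrization map is a submodule. -/
theorem apply_mem_range_symm (hp : d.IsGradedBy (parity (𝕜 := 𝕜) (V := g)) b.deg)
    (hτ : ∀ (q r : ZMod 2) (x z : g), x ∈ parity (𝕜 := 𝕜) q → z ∈ parity (𝕜 := 𝕜) r →
      τ (br (𝕜 := 𝕜) x z) = τ x * τ z - superSign 𝕜 q r • (τ z * τ x))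
    {v : M} (hv : ∀ x, (∀ i, d.c i x = 0) → τ x v = d.lam x • v) (x : g) {m : M}
    (hm : m ∈ LinearMap.range (d.symm b τ v)) : τ x m ∈ LinearMap.range (d.symm b τ v) := by
  have h (q : ZMod 2) (x : g) (hx : x ∈ parity (𝕜 := 𝕜) q) (a : SuperSymmetric 𝕜 V) :
      τ x (d.symm b τ v a) ∈ LinearMap.range (d.symm b τ v) := by
    obtain ⟨n, hn⟩ := exists_mem_filt a
    refine filt_le (W := (LinearMap.range (d.symm b τ v)).comap (τ x ∘ₗ d.symm b τ v))
      (fun k _ a ha => ?_) hn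
    rw [Submodule.mem_comap, LinearMap.comp_apply]
    refine (Submodule.sub_mem_iff_left _ (LinearMap.mem_range_self _ (d.mulProj b x a))).1 ?_
    obtain ⟨a', _, h⟩ := symm_mulProj_sub_mem hp hτ hv k q x hx a ha
    exact ⟨a', h⟩
  obtain ⟨a, rfl⟩ := hm
  obtain ⟨y, hy, z, hz, rfl⟩ := SuperModule.eq_sup (𝕜 := 𝕜) x
  rw [map_add, LinearMap.add_apply]
  exact add_mem (h _ y hy a) (h _ z hz a)

/-- A module which is generated by `v`, and which has the Fock space as a quotient, is isomorphic to
the Fock space. -/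
theorem bijective_symm (hp : d.IsGradedBy (parity (𝕜 := 𝕜) (V := g)) b.deg)
    (hτ : ∀ (q r : ZMod 2) (x z : g), x ∈ parity (𝕜 := 𝕜) q → z ∈ parity (𝕜 := 𝕜) r →
      τ (br (𝕜 := 𝕜) x z) = τ x * τ z - superSign 𝕜 q r • (τ z * τ x))
    {v : M} (hv : ∀ x, (∀ i, d.c i x = 0) → τ x v = d.lam x • v)
    (hgen : ∀ W : Submodule 𝕜 M, v ∈ W → (∀ x, ∀ m ∈ W, τ x m ∈ W) → W = ⊤)
    (π : M →ₗ[𝕜] SuperSymmetric 𝕜 V) (hπ : ∀ x m, π (τ x m) = d.field b x (π m))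
    (hπv : π v = 1) :
    Function.Bijective (d.symm b τ v) ∧
      ∀ x a, d.symm b τ v (d.field b x a) = τ x (d.symm b τ v a) := by
  -- Both maps satisfy the Euler recursion for the action by `d.field b`, the identity because `∑ eᵢ
  -- ∂ᵢ = E`, and both fix `1`.
  have hinv : π ∘ₗ d.symm b τ v = LinearMap.id := by
    refine eq_of_euler (d := d) (b := b) (τ := d.field b) (fun a => ?_) (fun a => ?_) ?_
    · simp [symm_euler, hπ]
    · simp [← sum_field_mul_partialDeriv hp]
    · simp [symm_one, hπv]
  have hinv' (a : SuperSymmetric 𝕜 V) : π (d.symm b τ v a) = a := LinearMap.congr_fun hinv a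
  have hsurj : Function.Surjective (d.symm b τ v) := by
    rw [← LinearMap.range_eq_top]
    exact hgen _ ⟨1, symm_one v⟩ fun x m hm => apply_mem_range_symm hp hτ hv x hm
  refine ⟨⟨fun a a' h => ?_, hsurj⟩, fun x a => ?_⟩
  · rw [← hinv' a, h, hinv']
  -- Equivariance comes from that of the left inverse `π`: applying `π` to a preimage identifies it
  -- with `d.field b x a`.
  · obtain ⟨a', h⟩ := hsurj (τ x (d.symm b τ v a))
    have h2 := congrArg π h
    rw [hinv', hπ, hinv'] at h2
    rw [← h2, h]

end InducingDatum

/-! ## Enveloping algebras and induced modules -/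

namespace SuperEnveloping

variable {𝕜 g A : Type*} [Field 𝕜] [AddCommGroup g] [Module 𝕜 g]
  [LieSuperalgebra 𝕜 g] [Ring A] [Algebra 𝕜 A]

theorem lift_ι (f : g →ₗ[𝕜] A)
    (hf : ∀ (i j : ZMod 2) (x y : g), x ∈ parity (𝕜 := 𝕜) i → y ∈ parity (𝕜 := 𝕜) j →
      f (br (𝕜 := 𝕜) x y) = f x * f y - superSign 𝕜 i j • (f y * f x)) (x : g) :
    lift f hf (ι 𝕜 x) = f x := by
  have := RingQuot.liftAlgHom_mkAlgHom_apply 𝕜 (TensorAlgebra.lift 𝕜 f)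
    (s := SuperEnveloping.Rel 𝕜 g) (by
      rintro _ _ ⟨hx, hy⟩
      simpa using hf _ _ _ _ hx hy) (TensorAlgebra.ι 𝕜 x)
  rw [TensorAlgebra.lift_ι_apply] at this
  exact this

/-- `U(g)` is generated by `g`. -/
theorem eq_top_of_ι_mem {S : Subalgebra 𝕜 (SuperEnveloping 𝕜 g)} (h : ∀ x, ι 𝕜 x ∈ S) : S = ⊤ := by
  let mk : TensorAlgebra 𝕜 g →ₐ[𝕜] SuperEnveloping 𝕜 g := RingQuot.mkAlgHom 𝕜 (Rel 𝕜 g)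
  rw [eq_top_iff]
  rintro a -
  obtain ⟨t, rfl⟩ : ∃ t, mk t = a := RingQuot.mkAlgHom_surjective 𝕜 (Rel 𝕜 g) a
  induction t using TensorAlgebra.induction with
  | algebraMap r => rw [AlgHom.commutes]; exact S.algebraMap_mem r
  | ι x => exact h x
  | mul s t hs ht => rw [map_mul]; exact S.mul_mem hs ht
  | add s t hs ht => rw [map_add]; exact S.add_mem hs ht

/-- A subspace of a `U(g)`-module which is stable under `g` is a submodule. -/
theorem smul_mem_of_ι_smul_mem {M : Type*} [AddCommGroup M] [Module 𝕜 M]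
    [Module (SuperEnveloping 𝕜 g) M] [IsScalarTower 𝕜 (SuperEnveloping 𝕜 g) M]
    {W : Submodule 𝕜 M} (h : ∀ x : g, ∀ m ∈ W, ι 𝕜 x • m ∈ W) (u : SuperEnveloping 𝕜 g) {m : M}
    (hm : m ∈ W) : u • m ∈ W := by
  let S : Subalgebra 𝕜 (SuperEnveloping 𝕜 g) :=
    { carrier := {u | ∀ m ∈ W, u • m ∈ W}
      mul_mem' := fun hu hu' m hm => by rw [mul_smul]; exact hu _ (hu' m hm)
      add_mem' := fun hu hu' m hm => by rw [add_smul]; exact add_mem (hu m hm) (hu' m hm)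
      algebraMap_mem' := fun r m hm => by rw [algebraMap_smul]; exact W.smul_mem r hm }
  have hS : S = ⊤ := eq_top_of_ι_mem h
  exact (hS ▸ Algebra.mem_top : u ∈ S) m hm

end SuperEnveloping

/-- The universal property of an induced module. -/
theorem InducedModule.exists_lift {𝕜 A B N P : Type*} [Field 𝕜] [Ring A] [Algebra 𝕜 A] [Ring B]
    [Algebra 𝕜 B] [AddCommGroup N] [Module 𝕜 N] [AddCommGroup P] [Module 𝕜 P] (f : B →ₐ[𝕜] A)
    (ρ : B →ₐ[𝕜] Module.End 𝕜 N) (σ : A →ₐ[𝕜] Module.End 𝕜 P) (j : N →ₗ[𝕜] P)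
    (h : ∀ c n, σ (f c) (j n) = j (ρ c n)) :
    ∃ π : InducedModule f ρ →ₗ[𝕜] P, (∀ a m, π (a • m) = σ a (π m)) ∧
      ∀ a n, π (Submodule.Quotient.mk (a ⊗ₜ[𝕜] n)) = σ a (j n) := by
  let F : A ⊗[𝕜] N →ₗ[𝕜] P := TensorProduct.lift (LinearMap.lcomp 𝕜 P j ∘ₗ σ.toLinearMap)
  have hF (a : A) (n : N) : F (a ⊗ₜ n) = σ a (j n) := by simp [F]
  have hsmul (a : A) (t : A ⊗[𝕜] N) : F (a • t) = σ a (F t) := by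
    induction t with
    | zero => simp
    | tmul a' n => rw [TensorProduct.smul_tmul', hF, hF, smul_eq_mul, map_mul]; rfl
    | add t t' h h' => rw [smul_add, map_add, map_add, map_add, h, h']
  have hker : (balancedRelations f ρ).restrictScalars 𝕜 ≤ LinearMap.ker F := by
    intro t ht
    rw [Submodule.restrictScalars_mem] at ht
    induction ht using Submodule.span_induction with
    | mem t ht =>
      obtain ⟨a, c, n, rfl⟩ := ht
      rw [LinearMap.mem_ker, map_sub, hF, hF, map_mul, Module.End.mul_apply, h, sub_self]
    | zero => exact zero_mem _
    | add t t' _ _ h h' => exact add_mem h h'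
    | smul a t _ h => rw [LinearMap.mem_ker] at h ⊢; rw [hsmul, h, map_zero]
  let π : InducedModule f ρ →ₗ[𝕜] P :=
    (Submodule.liftQ _ F hker) ∘ₗ
      (Submodule.Quotient.restrictScalarsEquiv 𝕜 (balancedRelations f ρ)).symm.toLinearMap
  have hπ (t : A ⊗[𝕜] N) : π (Submodule.Quotient.mk t) = F t := rfl
  refine ⟨π, fun a m => ?_, fun a n => (hπ _).trans (hF a n)⟩
  obtain ⟨t, rfl⟩ := Submodule.Quotient.mk_surjective _ m
  rw [← Submodule.Quotient.mk_smul, hπ, hπ, hsmul]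

/-! ## Membership in the Weyl superalgebras -/

namespace InducingDatum

open SuperSymmetric

variable {I 𝕜 g V : Type*} [DecidableEq I] [Fintype I] [Field 𝕜] [CharZero 𝕜] [AddCommGroup g]
    [Module 𝕜 g] [LieSuperalgebra 𝕜 g] [AddCommGroup V] [Module 𝕜 V] [SuperModule 𝕜 V]
    {d : InducingDatum I 𝕜 g} {b : SuperBasis I 𝕜 V}

theorem mulBasis_mem_weyl (i : I) : b.mulBasis i ∈ WeylSuper 𝕜 V :=
  Algebra.subset_adjoin (Or.inl ⟨_, rfl⟩)

theorem partialDeriv_mem_weyl (i : I) : b.partialDeriv i ∈ WeylSuper 𝕜 V :=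
  Algebra.subset_adjoin (Or.inr ⟨_, b.isSuperDerivation_partialDeriv i⟩)

theorem field_mem {S : Subalgebra 𝕜 (Module.End 𝕜 (SuperSymmetric 𝕜 V))} {x : g}
    (hm : ∀ i, b.mulBasis i ∈ S) (hc : ∀ j, d.coeffOp b j x ∈ S) : d.field b x ∈ S := by
  rw [field_apply]
  exact add_mem (sum_mem fun i _ => mul_mem (hm i) (hc _)) (hc none)

theorem field_mem_completedWeyl (hp : d.IsGradedBy (parity (𝕜 := 𝕜) (V := g)) b.deg) (x : g) :
    d.field b x ∈ CompletedWeylSuper 𝕜 V := by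
  refine field_mem (fun i => Algebra.subset_adjoin (Or.inl (mulBasis_mem_weyl i))) fun j =>
    Algebra.subset_adjoin (Or.inr ⟨fun k => d.coeff b.partialDeriv k j x, fun k => ?_,
      fun n a ha => b.evalSeries_apply_homog _ ha⟩)
  obtain ⟨y, hy, z, hz, rfl⟩ := SuperModule.eq_sup (𝕜 := 𝕜) x
  change d.coeff b.partialDeriv k j (y + z) ∈ _
  rw [map_add]
  exact add_mem (words_le_pow b.partialDeriv_mem_partials k _ (hp.coeff_mem _ k j hy))
    (words_le_pow b.partialDeriv_mem_partials k _ (hp.coeff_mem _ k j hz))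

/-- A word of length `k` in symbols of negative integral weight has weight at most `-k`, whereas the
weight of the coefficient is fixed by `x` and `j`. So each coefficient is a polynomial. -/
theorem field_mem_weyl (hp : d.IsGradedBy (parity (𝕜 := 𝕜) (V := g)) b.deg)
    {𝒢 : ℤ → Submodule 𝕜 g} {wt : I → ℤ} (hG : d.IsGradedBy 𝒢 wt) (hwt : ∀ i, wt i < 0) {n : ℤ}
    {x : g} (hx : x ∈ 𝒢 n) : d.field b x ∈ WeylSuper 𝕜 V := by
  refine field_mem mulBasis_mem_weyl fun j => ?_
  -- The weight of the coefficient is `j.elim 0 wt - n`. When the bound is negative, `toNat` makes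
  -- it `0`, which merely keeps a vanishing constant term in the sum.
  have h0 (k : ℕ) (hk : (n - j.elim 0 wt).toNat < k) : d.coeff b.partialDeriv k j x = 0 := by
    have h := hG.coeff_mem b.partialDeriv k j hx
    rwa [words_eq_bot hwt (by omega), Submodule.mem_bot] at h
  have hsum : d.coeffOp b j x = ∑ k ∈ Finset.range ((n - j.elim 0 wt).toNat + 1),
      d.coeff b.partialDeriv k j x := by
    refine linearMap_ext fun m a ha => ?_
    rw [coeffOp_apply, b.evalSeries_apply_filt (fun k => isLowering_coeff hp k j x)
      (homog_le_filt (le_max_left m (n - j.elim 0 wt).toNat) ha), LinearMap.sum_apply]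
    refine (Finset.sum_subset (Finset.range_mono (by omega)) fun k _ hk => ?_).symm
    have hk' := Finset.mem_range.not.1 hk
    rw [h0 k (by omega), LinearMap.zero_apply]
  rw [hsum]
  exact sum_mem fun k _ => words_le_toSubmodule partialDeriv_mem_weyl k _ (hG.coeff_mem _ k j hx)

/-- The vector fields form a morphism of Lie superalgebras to any algebra which contains them. -/
theorem exists_isLieSuperHom (hp : d.IsGradedBy (parity (𝕜 := 𝕜) (V := g)) b.deg)
    {S : Subalgebra 𝕜 (Module.End 𝕜 (SuperSymmetric 𝕜 V))} (hS : ∀ x, d.field b x ∈ S) :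
    ∃ φ : g →ₗ[𝕜] S, IsLieSuperHom (𝕜 := 𝕜) (g := g) (A := S) (subPar 𝕜 V S) φ ∧
      ∀ x, (φ x : Module.End 𝕜 _) = d.field b x :=
  ⟨{ toFun := fun x => ⟨d.field b x, hS x⟩
     map_add' := fun x y => Subtype.ext (map_add _ x y)
     map_smul' := fun c x => Subtype.ext (map_smul _ c x) },
   { map_parity := fun _ _ hx => field_mem_endPar hp hx
     map_br := fun i j x y hx hy => Subtype.ext (field_br hp i j x y hx hy) }, fun _ => rfl⟩

end InducingDatum

/-! ## Homogeneous bases of graded Lie superalgebras -/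

theorem SuperModule.isInternal_parity (𝕜 V : Type*) [Field 𝕜] [AddCommGroup V] [Module 𝕜 V]
    [SuperModule 𝕜 V] : DirectSum.IsInternal (parity (𝕜 := 𝕜) (V := V)) :=
  (DirectSum.isInternal_submodule_iff_isCompl _ (i := 0) (j := 1) (by decide)
    (Set.eq_univ_of_forall (by decide : ∀ i : ZMod 2, i = 0 ∨ i = 1)).symm).2 SuperModule.isCompl

theorem SuperBasis.exists_finite (𝕜 V : Type*) [Field 𝕜] [AddCommGroup V] [Module 𝕜 V]
    [SuperModule 𝕜 V] [FiniteDimensional 𝕜 V] :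
    ∃ (I : Type) (_ : Fintype I), Nonempty (SuperBasis I 𝕜 V) :=
  ⟨_, inferInstance, ⟨{
    basis := (SuperModule.isInternal_parity 𝕜 V).collectedBasis fun i =>
      Module.finBasis 𝕜 (parity (𝕜 := 𝕜) (V := V) i)
    deg := Sigma.fst
    mem := fun s => (SuperModule.isInternal_parity 𝕜 V).collectedBasis_mem _ s }⟩⟩

/-- A graded subspace of a super vector space is a super vector space. -/
abbrev SuperModule.restrict {𝕜 V : Type*} [Field 𝕜] [AddCommGroup V] [Module 𝕜 V]
    [SuperModule 𝕜 V] (W : Submodule 𝕜 V) (h : ∀ x ∈ W, ∃ y ∈ W ⊓ parity (𝕜 := 𝕜) 0,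
      ∃ z ∈ W ⊓ parity (𝕜 := 𝕜) 1, y + z = x) : SuperModule 𝕜 W where
  parity i := (parity (𝕜 := 𝕜) (V := V) i).comap W.subtype
  isCompl := by
    constructor
    · rw [Submodule.disjoint_def]
      intro x hx hy
      exact Subtype.ext (SuperModule.eq_zero_of_mem zero_ne_one hx hy)
    · rw [codisjoint_iff, eq_top_iff]
      rintro ⟨x, hx⟩ -
      obtain ⟨y, hy, z, hz, rfl⟩ := h x hx
      exact Submodule.mem_sup.2 ⟨⟨y, hy.1⟩, hy.2, ⟨z, hz.1⟩, hz.2, rfl⟩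

namespace LieSuperZGrading

variable {𝕜 g : Type*} [Field 𝕜] [AddCommGroup g] [Module 𝕜 g] [LieSuperalgebra 𝕜 g]
  (G : LieSuperZGrading 𝕜 g)

/-- Each graded piece is itself a super vector space, so bases homogeneous for parity can be chosen
piece by piece and collected; finite dimension makes the total index finite. -/
theorem exists_superBasis [FiniteDimensional 𝕜 g] :
    ∃ (J : Type) (_ : Fintype J) (b : SuperBasis J 𝕜 g) (wt : J → ℤ),
      (∀ j, b.basis j ∈ G.piece (wt j)) ∧
      ∀ n, ∀ x ∈ G.piece n, ∀ j, n ≠ wt j → b.basis.repr x j = 0 := by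
  have h (n : ℤ) : ∃ (I : Type) (v : Module.Basis I 𝕜 (G.piece n)) (deg : I → ZMod 2),
      ∀ i, (v i : g) ∈ parity (𝕜 := 𝕜) (deg i) := by
    let _ := SuperModule.restrict (G.piece n) (G.graded n)
    obtain ⟨I, _, ⟨b⟩⟩ := SuperBasis.exists_finite 𝕜 (G.piece n)
    exact ⟨I, b.basis, b.deg, b.mem⟩
  choose I v deg hv using h
  let B := G.isInternal.collectedBasis v
  refine ⟨_, FiniteDimensional.fintypeBasisIndex B, ⟨B, fun s => deg s.1 s.2, fun s => ?_⟩,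
    Sigma.fst, fun s => G.isInternal.collectedBasis_mem v s, fun n x hx s hs =>
      G.isInternal.collectedBasis_repr_of_mem_ne v hs hx⟩
  rw [DirectSum.IsInternal.collectedBasis_coe]
  exact hv _ _

/-- The elements of `k` are those with vanishing coordinates in negative degrees. -/
theorem mem_nonneg_iff {J : Type*} [Fintype J] {B : Module.Basis J 𝕜 g} {wt : J → ℤ}
    (hB : ∀ j, B j ∈ G.piece (wt j)) (hB' : ∀ n, ∀ x ∈ G.piece n, ∀ j, n ≠ wt j → B.repr x j = 0)
    {x : g} : x ∈ G.nonneg.toSubmodule ↔ ∀ j, wt j < 0 → B.repr x j = 0 := by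
  constructor
  · intro hx j hj
    change x ∈ ⨆ n : Set.Ici (0 : ℤ), G.piece n at hx
    induction hx using Submodule.iSup_induction' with
    | mem n x hx =>
      have hn : (0 : ℤ) ≤ n := n.2
      exact hB' n x hx j (by omega)
    | zero => simp
    | add x y _ _ hx hy => simp [hx, hy]
  · intro h
    rw [← B.sum_repr x]
    refine Submodule.sum_mem _ fun j _ => ?_
    by_cases hj : wt j < 0
    · simp [h j hj]
    · exact Submodule.smul_mem _ _ (Submodule.mem_iSup_of_mem
        (⟨wt j, not_lt.1 hj⟩ : Set.Ici (0 : ℤ)) (hB j))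

theorem repr_of_mem_neg {J : Type*} [Fintype J] {B : Module.Basis J 𝕜 g} {wt : J → ℤ}
    (hB' : ∀ n, ∀ x ∈ G.piece n, ∀ j, n ≠ wt j → B.repr x j = 0)
    {x : g} (hx : x ∈ G.neg.toSubmodule) (j : J) (hj : ¬ wt j < 0) : B.repr x j = 0 := by
  change x ∈ ⨆ n : Set.Iio (0 : ℤ), G.piece n at hx
  induction hx using Submodule.iSup_induction' with
  | mem n x hx =>
    have hn : (n : ℤ) < 0 := n.2
    exact hB' n x hx j (by omega)
  | zero => simp
  | add x y _ _ hx hy => simp [hx, hy]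

/-- The basis of `g₋` which consists of the basis vectors of negative degree. -/
def negBasis {J : Type*} [Fintype J] (b : SuperBasis J 𝕜 g) {wt : J → ℤ}
    (hB : ∀ j, b.basis j ∈ G.piece (wt j))
    (hB' : ∀ n, ∀ x ∈ G.piece n, ∀ j, n ≠ wt j → b.basis.repr x j = 0) :
    SuperBasis {j // wt j < 0} 𝕜 G.neg.toSubmodule where
  basis := Module.Basis.mk (v := fun j => ⟨b.basis j.1,
      Submodule.mem_iSup_of_mem (⟨wt j.1, j.2⟩ : Set.Iio (0 : ℤ)) (hB j.1)⟩)
    (LinearIndependent.of_comp G.neg.toSubmodule.subtype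
      (b.basis.linearIndependent.comp Subtype.val Subtype.val_injective)) (by
      rintro ⟨x, hx⟩ -
      have h : (⟨x, hx⟩ : G.neg.toSubmodule) = ∑ j : {j // wt j < 0}, b.basis.repr x j.1 •
          ⟨b.basis j.1, Submodule.mem_iSup_of_mem (⟨wt j.1, j.2⟩ : Set.Iio (0 : ℤ)) (hB j.1)⟩ := by
        refine Subtype.ext ?_
        rw [AddSubmonoidClass.coe_finsetSum]
        change x = ∑ j : {j // wt j < 0}, b.basis.repr x j.1 • b.basis j.1
        conv_lhs => rw [← b.basis.sum_repr x,
          ← Fintype.sum_subtype_add_sum_subtype (fun j => wt j < 0)]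
        rw [add_eq_left]
        exact Finset.sum_eq_zero fun j _ => by simp [G.repr_of_mem_neg hB' hx j.1 j.2]
      rw [h]
      exact Submodule.sum_mem _ fun j _ => Submodule.smul_mem _ _ (Submodule.subset_span ⟨j, rfl⟩))
  deg j := b.deg j.1
  mem j := by
    rw [Module.Basis.mk_apply]
    exact b.mem j.1

variable {G} {χ : G.zero.toSubmodule →ₗ[𝕜] 𝕜}

theorem _root_.IsSuperCharacter.eq_zero {χ : g →ₗ[𝕜] 𝕜} (hχ : IsSuperCharacter χ) {q : ZMod 2}
    (hq : q ≠ 0) {x : g} (hx : x ∈ parity (𝕜 := 𝕜) q) : χ x = 0 := by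
  simpa [scalarParity, hq] using hχ.map_parity q x hx

theorem _root_.IsSuperCharacter.br_eq_zero {χ : g →ₗ[𝕜] 𝕜} (hχ : IsSuperCharacter χ) (x y : g) :
    χ (br (𝕜 := 𝕜) x y) = 0 := by
  have h (q r : ZMod 2) (x y : g) (hx : x ∈ parity (𝕜 := 𝕜) q) (hy : y ∈ parity (𝕜 := 𝕜) r) :
      χ (br (𝕜 := 𝕜) x y) = 0 := by
    rw [hχ.map_br q r x y hx hy]
    by_cases hq : q = 0
    · simp [hq, mul_comm]
    · simp [hχ.eq_zero hq hx]
  obtain ⟨x₀, hx₀, x₁, hx₁, rfl⟩ := SuperModule.eq_sup (𝕜 := 𝕜) x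
  obtain ⟨y₀, hy₀, y₁, hy₁, rfl⟩ := SuperModule.eq_sup (𝕜 := 𝕜) y
  simp [h _ _ _ _ hx₀ hy₀, h _ _ _ _ hx₀ hy₁, h _ _ _ _ hx₁ hy₀, h _ _ _ _ hx₁ hy₁]

end LieSuperZGrading

/-! ## The regular representation and the parabolic Verma modules -/

namespace SuperBasis

variable {I 𝕜 g : Type*} [DecidableEq I] [Fintype I] [Field 𝕜] [AddCommGroup g]
    [Module 𝕜 g] [LieSuperalgebra 𝕜 g] (b : SuperBasis I 𝕜 g)

/-- The datum for inducing from the zero subalgebra. -/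
def regularDatum : InducingDatum I 𝕜 g where
  e := b.basis
  c := b.basis.coord
  lam := 0
  c_e i j := by rw [Module.Basis.coord_apply, b.basis.repr_self_apply]; simp [eq_comm]
  lam_e _ := rfl
  c_br x y hx _ i := by
    rw [b.basis.forall_coord_eq_zero_iff.1 hx]
    simp
  lam_br _ _ _ _ := rfl

theorem isGradedBy_regularDatum :
    b.regularDatum.IsGradedBy (parity (𝕜 := 𝕜) (V := g)) b.deg where
  e_mem := b.mem
  br_mem _ _ _ hx _ hy := LieSuperalgebra.br_mem hx hy
  c_eq_zero _ _ hi _ hx := b.repr_eq_zero hi hx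
  lam_eq_zero _ _ _ _ := rfl

/-- With the zero subalgebra and zero character, the operator of `x` sends `1` to `x` itself, and
the partial derivatives detect all coordinates of `x` in degree one. -/
theorem injective_field_regularDatum [CharZero 𝕜] :
    Function.Injective (b.regularDatum.field b) := by
  rw [injective_iff_map_eq_zero]
  intro x hx
  have h := LinearMap.congr_fun hx 1
  rw [InducingDatum.field_one, InducingDatum.mulProj_apply] at h
  have h1 : SuperSymmetric.ι 𝕜 x = 0 := by
    have := b.ι_mul_eq_sum x 1
    rw [mul_one] at this
    rw [this]
    simpa [regularDatum] using h
  refine b.basis.forall_coord_eq_zero_iff.1 fun i => ?_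
  have h2 := b.partialDeriv_ι i x
  rw [h1, map_zero, eq_comm] at h2
  exact (map_eq_zero_iff _ (FaithfulSMul.algebraMap_injective 𝕜 (SuperSymmetric 𝕜 g))).1 h2

end SuperBasis

namespace LieSuperZGrading

variable {J 𝕜 g : Type*} [DecidableEq J] [Fintype J] [Field 𝕜] [AddCommGroup g]
    [Module 𝕜 g] [LieSuperalgebra 𝕜 g] (G : LieSuperZGrading 𝕜 g) (b : SuperBasis J 𝕜 g)
    {wt : J → ℤ} (hB : ∀ j, b.basis j ∈ G.piece (wt j))
    (hB' : ∀ n, ∀ x ∈ G.piece n, ∀ j, n ≠ wt j → b.basis.repr x j = 0)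
    {χ : G.zero.toSubmodule →ₗ[𝕜] 𝕜}

/-- The datum for inducing the character `χ` from `k = g₀ ⊕ g₊`. -/
def vermaDatum (hχ : IsSuperCharacter χ) : InducingDatum {j // wt j < 0} 𝕜 g where
  e j := b.basis j
  c j := b.basis.coord j
  lam := χ ∘ₗ G.proj
  c_e i j := by
    rw [Module.Basis.coord_apply, b.basis.repr_self_apply]
    simp [eq_comm, Subtype.ext_iff]
  lam_e i := by
    rw [LinearMap.comp_apply, G.proj_of_mem_ne i.2.ne (hB i), map_zero]
  c_br x y hx hy i := by
    refine (G.mem_nonneg_iff hB hB').1 (G.nonneg.br_mem' x ?_ y ?_) i i.2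
    · exact (G.mem_nonneg_iff hB hB').2 fun j hj => hx ⟨j, hj⟩
    · exact (G.mem_nonneg_iff hB hB').2 fun j hj => hy ⟨j, hj⟩
  lam_br x y hx hy := by
    have h := G.proj_br ⟨x, (G.mem_nonneg_iff hB hB').2 fun j hj => hx ⟨j, hj⟩⟩
      ⟨y, (G.mem_nonneg_iff hB hB').2 fun j hj => hy ⟨j, hj⟩⟩
    exact (congrArg χ h).trans (hχ.br_eq_zero _ _)

theorem vermaDatum_c_eq_zero_iff (hχ : IsSuperCharacter χ) (x : g) :
    (∀ i, (G.vermaDatum b hB hB' hχ).c i x = 0) ↔ x ∈ G.nonneg.toSubmodule :=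
  ⟨fun h => (G.mem_nonneg_iff hB hB').2 fun j hj => h ⟨j, hj⟩,
    fun h i => (G.mem_nonneg_iff hB hB').1 h i i.2⟩

theorem isGradedBy_parity (hχ : IsSuperCharacter χ) :
    (G.vermaDatum b hB hB' hχ).IsGradedBy (parity (𝕜 := 𝕜) (V := g))
      (G.negBasis b hB hB').deg where
  e_mem i := b.mem i
  br_mem _ _ _ hx _ hy := LieSuperalgebra.br_mem hx hy
  c_eq_zero _ _ hi _ hx := b.repr_eq_zero hi hx
  lam_eq_zero _ hq _ hx := hχ.eq_zero hq (G.proj_parity hx)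

theorem isGradedBy_piece (hχ : IsSuperCharacter χ) :
    (G.vermaDatum b hB hB' hχ).IsGradedBy G.piece (fun j => wt j) where
  e_mem i := hB i
  br_mem m n x hx y hy := G.br_mem m n x hx y hy
  c_eq_zero n i hi x hx := hB' n x hx i hi
  lam_eq_zero _ hn _ hx := (congrArg χ (G.proj_of_mem_ne hn hx)).trans (map_zero χ)

variable [CharZero 𝕜]

theorem field_vermaDatum_mem_weyl (hχ : IsSuperCharacter χ) (x : g) :
    (G.vermaDatum b hB hB' hχ).field (G.negBasis b hB hB') x
      ∈ WeylSuper 𝕜 G.neg.toSubmodule := by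
  have hx : x ∈ ⨆ n, G.piece n := by
    rw [G.isInternal.submodule_iSup_eq_top]; trivial
  induction hx using Submodule.iSup_induction' with
  | mem n x hx =>
    exact InducingDatum.field_mem_weyl (G.isGradedBy_parity b hB hB' hχ)
      (G.isGradedBy_piece b hB hB' hχ) (fun j => j.2) hx
  | zero => rw [map_zero]; exact zero_mem _
  | add x y _ _ hx hy => rw [map_add]; exact add_mem hx hy

/-- The action of `g` on a parabolic Verma module. -/
def vermaAction (hχ : IsSuperCharacter χ) : g →ₗ[𝕜] Module.End 𝕜 (G.Verma hχ) :=
  (Algebra.lsmul 𝕜 𝕜 (G.Verma hχ)).toLinearMap ∘ₗ SuperEnveloping.ι 𝕜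

/-- The parabolic Verma module is isomorphic to the Fock space. -/
theorem exists_verma_equiv (hχ : IsSuperCharacter χ) :
    ∃ e : SuperSymmetric 𝕜 G.neg.toSubmodule ≃ₗ[𝕜] G.Verma hχ,
      e 1 = Submodule.Quotient.mk (1 ⊗ₜ[𝕜] 1) ∧
      ∀ (x : g) (a : SuperSymmetric 𝕜 G.neg.toSubmodule),
        e ((G.vermaDatum b hB hB' hχ).field (G.negBasis b hB hB') x a)
          = SuperEnveloping.ι 𝕜 x • e a := by
  let d := G.vermaDatum b hB hB' hχ
  let bn := G.negBasis b hB hB'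
  have hp : d.IsGradedBy (parity (𝕜 := 𝕜) (V := g)) bn.deg := G.isGradedBy_parity b hB hB' hχ
  let σ := SuperEnveloping.lift (d.field bn) (InducingDatum.field_br hp)
  let v : G.Verma hχ := Submodule.Quotient.mk (1 ⊗ₜ[𝕜] 1)
  have hincl (x : G.nonneg.toSubmodule) : SuperEnveloping.incl G.nonneg (SuperEnveloping.ι 𝕜 x)
      = SuperEnveloping.ι 𝕜 (x : g) := SuperEnveloping.lift_ι _ _ x
  have hscalar (x : G.nonneg.toSubmodule) :
      G.scalarModule hχ (SuperEnveloping.ι 𝕜 x) 1 = d.lam x := by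
    simp only [scalarModule, AlgHom.comp_apply, SuperEnveloping.lift_ι]
    simp [extend, d, vermaDatum]
  -- The vector `1` of the polynomial model spans a copy of the inducing module. This is the
  -- balancing condition needed to map the Verma module to the model.
  have hσ (c : SuperEnveloping 𝕜 G.nonneg.toSubmodule) :
      σ (SuperEnveloping.incl G.nonneg c) 1 = G.scalarModule hχ c 1 • 1 := by
    let S : Subalgebra 𝕜 (SuperEnveloping 𝕜 G.nonneg.toSubmodule) :=
      { carrier := {c | σ (SuperEnveloping.incl G.nonneg c) 1 = G.scalarModule hχ c 1 • 1}
        mul_mem' := fun {c c'} hc hc' => by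
          have hs : G.scalarModule hχ (c * c') 1
              = G.scalarModule hχ c' 1 * G.scalarModule hχ c 1 := by
            simp [scalarModule, mul_comm]
          simp only [Set.mem_ofPred_eq] at hc hc' ⊢
          rw [map_mul, map_mul, Module.End.mul_apply, hc', map_smul, hc, hs, mul_smul]
        add_mem' := fun {c c'} hc hc' => by
          simp only [Set.mem_ofPred_eq] at hc hc' ⊢
          rw [map_add, map_add, map_add, LinearMap.add_apply, LinearMap.add_apply, hc, hc',
            add_smul]
        algebraMap_mem' := fun r => by simp }
    have hS : S = ⊤ := SuperEnveloping.eq_top_of_ι_mem fun x => by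
      change σ (SuperEnveloping.incl G.nonneg (SuperEnveloping.ι 𝕜 x)) 1 = _
      have h3 := (G.vermaDatum_c_eq_zero_iff b hB hB' hχ x).2 x.2
      rw [hincl, hscalar, SuperEnveloping.lift_ι, InducingDatum.field_one, InducingDatum.mulProj_apply]
      simp [d, h3]
    exact (hS ▸ Algebra.mem_top : c ∈ S)
  obtain ⟨π, hπ, hπ'⟩ := InducedModule.exists_lift (SuperEnveloping.incl G.nonneg)
    (G.scalarModule hχ) σ ((1 : 𝕜 →ₗ[𝕜] 𝕜).smulRight 1) fun c n => by
      have hn : G.scalarModule hχ c n = n * G.scalarModule hχ c 1 := by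
        simp [scalarModule, mul_comm]
      simp [hσ, hn, mul_smul]
  have h := InducingDatum.bijective_symm (b := bn) (τ := G.vermaAction hχ) (v := v) hp ?_ ?_ ?_ π
    ?_ ?_
  · refine ⟨LinearEquiv.ofBijective _ h.1, InducingDatum.symm_one v, fun x a => h.2 x a⟩
  · intro q r x z hx hz
    simp only [vermaAction, LinearMap.comp_apply, SuperEnveloping.ι_br hx hz]
    simp
  · intro x hx
    have hx' : x ∈ G.nonneg.toSubmodule := (G.vermaDatum_c_eq_zero_iff b hB hB' hχ x).1 hx
    -- The balancing relation with `a = 1` and `b = x` says that `x` in the subalgebra acts on the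
    -- generator by its character.
    have h1 : (SuperEnveloping.ι 𝕜 x * 1) ⊗ₜ[𝕜] (1 : 𝕜) - 1 ⊗ₜ[𝕜] d.lam x
        ∈ balancedRelations (SuperEnveloping.incl G.nonneg) (G.scalarModule hχ) :=
      Submodule.subset_span ⟨1, SuperEnveloping.ι 𝕜 ⟨x, hx'⟩, 1, by
        rw [hincl, hscalar, one_mul, mul_one]⟩
    have h2 := (Submodule.Quotient.eq _).2 h1
    change SuperEnveloping.ι 𝕜 x • v = d.lam x • v
    rw [← Submodule.Quotient.mk_smul, ← Submodule.Quotient.mk_smul, TensorProduct.smul_tmul',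
      ← TensorProduct.tmul_smul, smul_eq_mul, smul_eq_mul, mul_one (d.lam x)]
    exact h2
  · intro W hv hW
    rw [eq_top_iff]
    rintro m -
    obtain ⟨t, rfl⟩ := Submodule.Quotient.mk_surjective _ m
    induction t with
    | zero => exact zero_mem _
    | add t t' h h' => exact add_mem h h'
    | tmul a c =>
      have h1 : (Submodule.Quotient.mk (a ⊗ₜ[𝕜] c) : G.Verma hχ) = a • c • v := by
        rw [← Submodule.Quotient.mk_smul, ← Submodule.Quotient.mk_smul, ← TensorProduct.tmul_smul,
          TensorProduct.smul_tmul']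
        simp
      rw [h1]
      exact SuperEnveloping.smul_mem_of_ι_smul_mem hW a (W.smul_mem c hv)
  · intro x m
    exact (hπ _ m).trans (by rw [SuperEnveloping.lift_ι])
  · rw [hπ']
    simp

end LieSuperZGrading

end

/-! ### Realizations in the completed and polynomial Weyl superalgebras -/

theorem theorem3p1 {𝕜 g : Type*} [RCLike 𝕜] [AddCommGroup g] [Module 𝕜 g]
    [LieSuperalgebra 𝕜 g] [FiniteDimensional 𝕜 g] :
    (∃ φ : g →ₗ[𝕜] CompletedWeylSuper 𝕜 g,
      IsLieSuperHom (𝕜 := 𝕜) (g := g) (A := CompletedWeylSuper 𝕜 g)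
        (SuperSymmetric.subPar 𝕜 g (CompletedWeylSuper 𝕜 g)) φ ∧
      Function.Injective φ) ∧
    ∀ (G : LieSuperZGrading 𝕜 g) (χ : G.zero.toSubmodule →ₗ[𝕜] 𝕜) (hχ : IsSuperCharacter χ),
      ∃ φ : g →ₗ[𝕜] WeylSuper 𝕜 G.neg.toSubmodule,
        IsLieSuperHom (𝕜 := 𝕜) (g := g) (A := WeylSuper 𝕜 G.neg.toSubmodule)
          (SuperSymmetric.subPar 𝕜 G.neg.toSubmodule (WeylSuper 𝕜 G.neg.toSubmodule)) φ ∧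
        (∃ e : SuperSymmetric 𝕜 G.neg.toSubmodule ≃ₗ[𝕜] G.Verma hχ,
          e 1 = Submodule.Quotient.mk (1 ⊗ₜ[𝕜] 1) ∧
          ∀ (x : g) (a : SuperSymmetric 𝕜 G.neg.toSubmodule),
            e ((φ x : Module.End 𝕜 (SuperSymmetric 𝕜 G.neg.toSubmodule)) a) =
              SuperEnveloping.ι 𝕜 x • e a) ∧
        (Function.Injective φ ↔ IsFaithfulSuperModule 𝕜 g (G.Verma hχ)) := by
  classical
  constructor
  · obtain ⟨I, _, ⟨b⟩⟩ := SuperBasis.exists_finite 𝕜 g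
    obtain ⟨φ, hφ, h⟩ := InducingDatum.exists_isLieSuperHom b.isGradedBy_regularDatum
      (InducingDatum.field_mem_completedWeyl b.isGradedBy_regularDatum)
    refine ⟨φ, hφ, fun x y hxy => b.injective_field_regularDatum ?_⟩
    rw [← h, ← h, hxy]
  · intro G χ hχ
    obtain ⟨J, _, b, wt, hB, hB'⟩ := G.exists_superBasis
    obtain ⟨φ, hφ, h⟩ := InducingDatum.exists_isLieSuperHom (G.isGradedBy_parity b hB hB' hχ)
      (G.field_vermaDatum_mem_weyl b hB hB' hχ)
    obtain ⟨e, he, he'⟩ := G.exists_verma_equiv b hB hB' hχ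
    simp only [← h] at he'
    refine ⟨φ, hφ, ⟨e, he, he'⟩, fun hinj x hx => ?_, fun hfaith => ?_⟩
    -- The kernel of `φ` and the annihilator of the Verma module in `g` correspond under the
    -- equivariant isomorphism `e`.
    · refine hinj (Subtype.ext (LinearMap.ext fun a => e.injective ?_))
      rw [he', hx, map_zero]
      simp
    · rw [injective_iff_map_eq_zero]
      refine fun x hx => hfaith x fun m => ?_
      rw [← e.apply_symm_apply m, ← he', hx]
      simp
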